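/- Let $b\ge 2$ be an integer, let $f(t)=\dfrac{4t^b}{(1+t^b)^2}$, and let $$F(t)=\sum_{n=0}^{\infty}\frac{1}{(2b)^n}\,\ln\bigl(1+(f^{\circ n}(t))^b\bigr),$$ where $f^{\circ n}$ is the $n$-fold iterate of $f$. Let $t_c$ be the fixed point of $f$ in $(0,1)$ (it is unique, and repelling), let $\lambda=f'(t_c)>1$ be its multiplier, and let $l$ be a natural number with $\lambda^l>2b$. Then $F$ is $C^\infty$ on $[0,t_c)$, and the $l$-th derivative of $F|_{[0,t_c]}$ is discontinuous at $t_c$; more precisely, $F^{(l)}(t)$ has no finite limit as $t\to t_c$, $t<t_c$. -/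

import Mathlib

open Set Filter Topology
open scoped ContDiff

/-- The renormalization map `f(t) = 4 t^b / (1 + t^b)^2`. -/
noncomputable def renormMap (b : ℕ) (t : ℝ) : ℝ :=
  4 * t ^ b / (1 + t ^ b) ^ 2

/-- The (normalized) free energy `F = ∑ₙ (2b)⁻ⁿ g ∘ f^n` with `g(t) = ln (1 + t^b)`.
On `[0, 1]`, which `f` maps into itself, the terms are dominated by `(2b)⁻ⁿ ln 2`. -/
noncomputable def freeEnergy (b : ℕ) (t : ℝ) : ℝ :=
  ∑' n : ℕ, ((2 * (b : ℝ)) ^ n)⁻¹ * Real.log (1 + ((renormMap b)^[n] t) ^ b)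

/-! Write `g(t) = log (1 + t^b)` and let `h` be the inverse branch of `f` fixing `t_c`. The relation
`F = g + F ∘ f / (2b)` reads `F = 2b (F ∘ h - g ∘ h)` on `(0, t_c)`. Near `0` the series converges
holomorphically, and every orbit starting in `[0, t_c)` tends to `0`, so the relation carries
smoothness from a neighbourhood of `0` to all of `[0, t_c)`.

For the singularity, suppose `F^(l)` is bounded to the left of `t_c`. Then `F = T + O((t_c - t)^l)`
for a polynomial `T`, whose defect `E = 2b (T ∘ h - g ∘ h) - T` vanishes to order `l` at `t_c`.
Since `h` contracts there by a factor `q` with `2b q^l < 1`, the series `S = ∑ (2b)^n E ∘ h^n`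
converges, and `G = T + S` solves the functional equation. The same contraction gives `G = F` on
`(0, t_c)`. As `h` maps the doubly slit plane into itself and attracts every point of it to `t_c`,
`G` is holomorphic on the whole slit plane (`exists_holomorphic_extension`).

Such a `G` cannot exist (`not_eqOn_holomorphic_solution`). Continuing `h` across the negative axis
and using holomorphy of `F` at `0` removes the cut `(-∞, 0]`; the symmetry `F(ζz) = F(z)` for `ζ^b =
1` then removes `[1, ∞)`. The resulting entire function is `O(√|v|)`, because `h` takes values in
the unit disc and only the logarithmic term can grow. Hence it is constant, whereas `F(0) = 0` and
`F > 0` to the right of `0`. -/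

/-- The plane slit along `(-∞, 0]` and `[1, ∞)`. -/
def doublySlitPlane : Set ℂ := {z | z ∈ Complex.slitPlane ∧ 1 - z ∈ Complex.slitPlane}

/-- The map `4 z ^ b / (1 + z ^ b) ^ 2` on the complex plane. -/
noncomputable def renormMapC (b : ℕ) (z : ℂ) : ℂ := 4 * z ^ b / (1 + z ^ b) ^ 2

/-- The principal branch of `log (1 + z ^ b)`. -/
noncomputable def logTerm (b : ℕ) (z : ℂ) : ℂ := Complex.log (1 + z ^ b)

/-- The inverse on `{v | 1 - v ∈ slitPlane}` of the Koebe-type map `κ ↦ 4 κ / (1 + κ) ^ 2` of the unit disc. -/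
noncomputable def koebeInv (v : ℂ) : ℂ := (1 - Complex.sqrt (1 - v)) / (1 + Complex.sqrt (1 - v))

/-- The branch of the inverse of `renormMapC b` that maps `(0, 1)` to itself. -/
noncomputable def invBranch (b : ℕ) (v : ℂ) : ℂ := koebeInv v ^ ((b : ℂ)⁻¹)

/-- The branch of the inverse of `renormMapC b` that continues `invBranch b` from the upper half
plane across the negative real axis. -/
noncomputable def invBranchNeg (b : ℕ) (v : ℂ) : ℂ :=
  Complex.exp (Real.pi * Complex.I / b) * (-koebeInv v) ^ ((b : ℂ)⁻¹)

/-! ### Inverting the Koebe-type map -/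

theorem sqrt_re_pos {z : ℂ} (hz : z ∈ Complex.slitPlane) : 0 < (Complex.sqrt z).re := by
  have h := Complex.mem_slitPlane_iff_arg.1 hz
  have h1 := Complex.neg_pi_lt_arg z
  have h2 := lt_of_le_of_ne (Complex.arg_le_pi z) h.1
  rw [Complex.sqrt, Complex.cpow_def_of_ne_zero h.2, Complex.exp_re]
  refine mul_pos (Real.exp_pos _) (Real.cos_pos_of_mem_Ioo ⟨?_, ?_⟩) <;>
  · simp [Complex.mul_im, Complex.log_im]
    linarith

theorem sqrt_sq (z : ℂ) : Complex.sqrt z ^ 2 = z := by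
  have := Complex.cpow_nat_inv_pow z (n := 2) two_ne_zero
  rwa [Nat.cast_ofNat] at this

theorem one_add_sqrt_ne_zero {v : ℂ} (hv : 1 - v ∈ Complex.slitPlane) :
    1 + Complex.sqrt (1 - v) ≠ 0 := by
  intro h
  have := congrArg Complex.re h
  have h2 := sqrt_re_pos hv
  simp at this
  linarith

theorem one_add_koebeInv {v : ℂ} (hv : 1 - v ∈ Complex.slitPlane) :
    1 + koebeInv v = 2 / (1 + Complex.sqrt (1 - v)) := by
  have := one_add_sqrt_ne_zero hv
  rw [koebeInv]; field_simp; ring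

theorem koebe_koebeInv {v : ℂ} (hv : 1 - v ∈ Complex.slitPlane) :
    4 * koebeInv v / (1 + koebeInv v) ^ 2 = v := by
  have h := one_add_sqrt_ne_zero hv
  have h2 := sqrt_sq (1 - v)
  rw [one_add_koebeInv hv, koebeInv]
  field_simp
  linear_combination -4 * h2

/-- The square root lies in the right half plane, which the Cayley transform `m ↦ (1 - m) / (1 + m)`
sends into the unit disc. -/
theorem norm_koebeInv_lt_one {v : ℂ} (hv : 1 - v ∈ Complex.slitPlane) : ‖koebeInv v‖ < 1 := by
  have h := one_add_sqrt_ne_zero hv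
  have h2 := sqrt_re_pos hv
  rw [koebeInv, norm_div, div_lt_one (norm_pos_iff.2 h), ← sq_lt_sq₀ (norm_nonneg _) (norm_nonneg _),
    ← Complex.normSq_eq_norm_sq, ← Complex.normSq_eq_norm_sq, Complex.normSq_apply,
    Complex.normSq_apply]
  simp
  nlinarith

theorem differentiableAt_koebeInv {v : ℂ} (hv : 1 - v ∈ Complex.slitPlane) :
    DifferentiableAt ℂ koebeInv v := by
  have hs : DifferentiableAt ℂ (fun v : ℂ => Complex.sqrt (1 - v)) v :=
    (Complex.differentiableAt_sqrt hv).comp v (by fun_prop)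
  exact (hs.const_sub 1).div (hs.const_add 1) (one_add_sqrt_ne_zero hv)

theorem koebeInv_real_eq {x : ℝ} {v : ℂ} (hv : 1 - v ∈ Complex.slitPlane)
    (h : koebeInv v = x) : v = ((4 * x / (1 + x) ^ 2 : ℝ) : ℂ) := by
  have := koebe_koebeInv hv
  rw [h] at this
  rw [← this]; push_cast; rfl

theorem koebeInv_mem_slitPlane {v : ℂ} (hv : v ∈ doublySlitPlane) :
    koebeInv v ∈ Complex.slitPlane := by
  by_contra h
  rw [Complex.mem_slitPlane_iff, not_or, not_lt, not_not] at h
  have hk : koebeInv v = ((koebeInv v).re : ℂ) := Complex.ext rfl (by simpa using h.2)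
  have h2 := koebeInv_real_eq hv.2 hk
  have h3 := hv.1
  rw [h2, Complex.ofReal_mem_slitPlane] at h3
  refine absurd h3 (not_lt.2 (div_nonpos_of_nonpos_of_nonneg ?_ (sq_nonneg _)))
  linarith [h.1]

theorem one_sub_mem_slitPlane_of_neg_mem {v : ℂ} (hv : -v ∈ Complex.slitPlane) :
    1 - v ∈ Complex.slitPlane := by
  rw [Complex.mem_slitPlane_iff] at *
  rcases hv with h | h
  · left; simp at h ⊢; linarith
  · right; simpa using h

theorem neg_koebeInv_mem_slitPlane {v : ℂ} (hv : -v ∈ Complex.slitPlane) :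
    -koebeInv v ∈ Complex.slitPlane := by
  have hv' := one_sub_mem_slitPlane_of_neg_mem hv
  by_contra h
  rw [Complex.mem_slitPlane_iff, not_or, not_lt, not_not] at h
  simp at h
  have hk : koebeInv v = ((koebeInv v).re : ℂ) := Complex.ext rfl (by simpa using h.2)
  have h2 := koebeInv_real_eq hv' hk
  have h3 := hv
  rw [h2, ← Complex.ofReal_neg, Complex.ofReal_mem_slitPlane] at h3
  have : 0 ≤ 4 * (koebeInv v).re / (1 + (koebeInv v).re) ^ 2 :=
    div_nonneg (by linarith [h.1]) (sq_nonneg _)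
  linarith

/-- The square of the root has negative imaginary part and the root has positive real part, so its
imaginary part is negative; the Cayley transform reverses that sign. -/
theorem koebeInv_im_pos {v : ℂ} (hv : 0 < v.im) : 0 < (koebeInv v).im := by
  have hs : 1 - v ∈ Complex.slitPlane := by
    rw [Complex.mem_slitPlane_iff]; right; simp; exact hv.ne'
  have h2 := sqrt_re_pos hs
  have h3 : (Complex.sqrt (1 - v)).im < 0 := by
    have := congrArg Complex.im (sqrt_sq (1 - v))
    simp [sq, Complex.mul_im] at this
    by_contra! hc
    nlinarith [mul_nonneg h2.le hc]
  have h := one_add_sqrt_ne_zero hs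
  rw [koebeInv, Complex.div_im]
  have hn := Complex.normSq_pos.2 h
  rw [← sub_div]
  refine div_pos ?_ hn
  simp
  nlinarith

/-! ### The two inverse branches of the renormalization map -/

theorem invBranch_pow {b : ℕ} (hb : b ≠ 0) (v : ℂ) : invBranch b v ^ b = koebeInv v :=
  Complex.cpow_nat_inv_pow _ hb

theorem invBranchNeg_pow {b : ℕ} (hb : b ≠ 0) (v : ℂ) : invBranchNeg b v ^ b = koebeInv v := by
  have hb' : (b : ℂ) ≠ 0 := by exact_mod_cast hb
  rw [invBranchNeg, mul_pow, Complex.cpow_nat_inv_pow _ hb, ← Complex.exp_nat_mul,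
    mul_div_cancel₀ _ hb', Complex.exp_pi_mul_I]
  ring

theorem renormMapC_invBranch {b : ℕ} (hb : b ≠ 0) {v : ℂ} (hv : 1 - v ∈ Complex.slitPlane) :
    renormMapC b (invBranch b v) = v := by
  rw [renormMapC, invBranch_pow hb, koebe_koebeInv hv]

theorem norm_invBranch_lt_one {b : ℕ} (hb : b ≠ 0) {v : ℂ} (hv : 1 - v ∈ Complex.slitPlane) :
    ‖invBranch b v‖ < 1 := by
  have := norm_koebeInv_lt_one hv
  rw [← invBranch_pow hb, norm_pow] at this
  exact (pow_lt_one_iff_of_nonneg (norm_nonneg _) hb).1 this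

theorem norm_invBranchNeg_lt_one {b : ℕ} (hb : b ≠ 0) {v : ℂ} (hv : 1 - v ∈ Complex.slitPlane) :
    ‖invBranchNeg b v‖ < 1 := by
  have := norm_koebeInv_lt_one hv
  rw [← invBranchNeg_pow hb, norm_pow] at this
  exact (pow_lt_one_iff_of_nonneg (norm_nonneg _) hb).1 this

theorem one_sub_mem_slitPlane_of_norm_lt_one {z : ℂ} (hz : ‖z‖ < 1) :
    1 - z ∈ Complex.slitPlane := by
  rw [sub_eq_add_neg]
  exact Complex.mem_slitPlane_of_norm_lt_one (by rwa [norm_neg])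

theorem cpow_natCast_inv_eq_exp (b : ℕ) {z : ℂ} (hz : z ≠ 0) :
    z ^ ((b : ℂ)⁻¹) = Complex.exp ((Real.log ‖z‖ / b : ℝ) + (z.arg / b : ℝ) * Complex.I) := by
  rw [Complex.cpow_def_of_ne_zero hz, Complex.log]
  congr 1
  push_cast
  ring

/-- The argument of the `b`-th root is smaller than `π / b ≤ π / 2` in absolute value, so the root
lies in the right half plane; its norm is below `1`, which avoids the other slit. -/
theorem invBranch_mem_doublySlitPlane {b : ℕ} (hb : 2 ≤ b) {v : ℂ} (hv : v ∈ doublySlitPlane) :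
    invBranch b v ∈ doublySlitPlane := by
  have hb0 : b ≠ 0 := by lia
  refine ⟨?_, one_sub_mem_slitPlane_of_norm_lt_one (norm_invBranch_lt_one hb0 hv.2)⟩
  have h := Complex.mem_slitPlane_iff_arg.1 (koebeInv_mem_slitPlane hv)
  rw [invBranch, cpow_natCast_inv_eq_exp b h.2, Complex.mem_slitPlane_iff]
  left
  rw [Complex.exp_re]
  have h1 := Complex.neg_pi_lt_arg (koebeInv v)
  have h2 := lt_of_le_of_ne (Complex.arg_le_pi (koebeInv v)) h.1
  have hb2 : (2 : ℝ) ≤ b := by exact_mod_cast hb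
  have hpi := Real.pi_pos
  refine mul_pos (Real.exp_pos _) (Real.cos_pos_of_mem_Ioo ⟨?_, ?_⟩)
  · simp
    rw [lt_div_iff₀ (by linarith)]
    nlinarith
  · simp
    rw [div_lt_iff₀ (by linarith)]
    nlinarith

/-- The argument of the value is `(π + arg (-κ)) / b`, which lies in `(0, 2π / b)` and hence in `(0,
π)`. -/
theorem invBranchNeg_im_pos {b : ℕ} (hb : 2 ≤ b) {v : ℂ} (hv : -v ∈ Complex.slitPlane) :
    0 < (invBranchNeg b v).im := by
  have hb0 : b ≠ 0 := by lia
  have h := Complex.mem_slitPlane_iff_arg.1 (neg_koebeInv_mem_slitPlane hv)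
  rw [invBranchNeg, cpow_natCast_inv_eq_exp b h.2, ← Complex.exp_add, Complex.exp_im]
  have h1 := Complex.neg_pi_lt_arg (-koebeInv v)
  have h2 := lt_of_le_of_ne (Complex.arg_le_pi (-koebeInv v)) h.1
  have hb2 : (2 : ℝ) ≤ b := by exact_mod_cast hb
  have hpi := Real.pi_pos
  have him : (Real.pi * Complex.I / b + ((Real.log ‖-koebeInv v‖ / b : ℝ) +
      ((-koebeInv v).arg / b : ℝ) * Complex.I)).im = (Real.pi + (-koebeInv v).arg) / b := by
    have : (Real.pi * Complex.I / b + ((Real.log ‖-koebeInv v‖ / b : ℝ) +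
      ((-koebeInv v).arg / b : ℝ) * Complex.I)) = ((Real.log ‖-koebeInv v‖ / b : ℝ) : ℂ) +
      ((Real.pi + (-koebeInv v).arg) / b : ℝ) * Complex.I := by push_cast; ring
    rw [this]; simp
  rw [him]
  refine mul_pos (Real.exp_pos _) (Real.sin_pos_of_pos_of_lt_pi ?_ ?_)
  · exact div_pos (by linarith) (by linarith)
  · rw [div_lt_iff₀ (by linarith)]
    nlinarith

theorem mem_doublySlitPlane_of_im_ne_zero {z : ℂ} (hz : z.im ≠ 0) : z ∈ doublySlitPlane := by
  constructor <;> rw [Complex.mem_slitPlane_iff] <;> right <;> simpa using hz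

theorem invBranchNeg_eq_invBranch (b : ℕ) {v : ℂ} (hv : 0 < v.im) :
    invBranchNeg b v = invBranch b v := by
  have hk := koebeInv_im_pos hv
  have hne : koebeInv v ≠ 0 := by intro h; simp [h] at hk
  rw [invBranchNeg, invBranch, cpow_natCast_inv_eq_exp b (neg_ne_zero.2 hne),
    cpow_natCast_inv_eq_exp b hne, ← Complex.exp_add,
    Complex.arg_neg_eq_arg_sub_pi_of_im_pos hk, norm_neg]
  congr 1
  push_cast
  ring

theorem differentiableAt_invBranch {b : ℕ} {v : ℂ} (hv : v ∈ doublySlitPlane) :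
    DifferentiableAt ℂ (invBranch b) v :=
  (differentiableAt_koebeInv hv.2).cpow_const (koebeInv_mem_slitPlane hv)

theorem differentiableAt_invBranchNeg {b : ℕ} {v : ℂ} (hv : -v ∈ Complex.slitPlane) :
    DifferentiableAt ℂ (invBranchNeg b) v :=
  ((differentiableAt_koebeInv (one_sub_mem_slitPlane_of_neg_mem hv)).neg.cpow_const
    (neg_koebeInv_mem_slitPlane hv)).const_mul _

/-! ### Geometry of the slit planes and the real map -/

theorem ofReal_mem_doublySlitPlane {x : ℝ} : (x : ℂ) ∈ doublySlitPlane ↔ x ∈ Ioo (0 : ℝ) 1 := by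
  have : (1 : ℂ) - x = ((1 - x : ℝ) : ℂ) := by push_cast; rfl
  rw [doublySlitPlane, mem_ofPred_eq, this, Complex.ofReal_mem_slitPlane,
    Complex.ofReal_mem_slitPlane, sub_pos, mem_Ioo]

theorem isOpen_doublySlitPlane : IsOpen doublySlitPlane :=
  Complex.isOpen_slitPlane.inter
    (Complex.isOpen_slitPlane.preimage (continuous_const.sub continuous_id))

theorem starConvex_one_sub_slitPlane {x : ℝ} (hx : x < 1) :
    StarConvex ℝ (x : ℂ) {z | 1 - z ∈ Complex.slitPlane} := by
  intro z hz s t hs ht hst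
  have h := Complex.starConvex_ofReal_slitPlane (sub_pos.2 hx) hz hs ht hst
  have hst' : (s : ℂ) + t = 1 := by exact_mod_cast hst
  simp only [Complex.real_smul, mem_ofPred_eq] at h ⊢
  convert h using 1
  push_cast
  linear_combination -hst'

theorem starConvex_doublySlitPlane {x : ℝ} (hx : x ∈ Ioo (0 : ℝ) 1) :
    StarConvex ℝ (x : ℂ) doublySlitPlane :=
  (Complex.starConvex_ofReal_slitPlane hx.1).inter (starConvex_one_sub_slitPlane hx.2)

theorem isPreconnected_doublySlitPlane : IsPreconnected doublySlitPlane := by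
  have h : (1 / 2 : ℝ) ∈ Ioo (0 : ℝ) 1 := by norm_num
  exact ((starConvex_doublySlitPlane h).isPathConnected
    (ofReal_mem_doublySlitPlane.2 h)).isConnected.isPreconnected

theorem renormMapC_ofReal (b : ℕ) (x : ℝ) : renormMapC b x = (renormMap b x : ℂ) := by
  simp [renormMapC, renormMap]

theorem renormMap_strictMonoOn {b : ℕ} (hb : b ≠ 0) : StrictMonoOn (renormMap b) (Icc 0 1) := by
  intro x hx y hy hxy
  have h1 : x ^ b < y ^ b := pow_lt_pow_left₀ hxy hx.1 hb
  have h2 : 0 ≤ x ^ b := pow_nonneg hx.1 b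
  have h3 : y ^ b ≤ 1 := pow_le_one₀ hy.1 hy.2
  have h5 : 0 < 1 + y ^ b := by linarith
  rw [renormMap, renormMap, div_lt_div_iff₀ (by positivity) (by positivity)]
  have h4 : x ^ b * y ^ b < 1 := by nlinarith
  nlinarith [mul_pos (sub_pos.2 h1) (sub_pos.2 h4)]

theorem renormMap_one {b : ℕ} : renormMap b 1 = 1 := by norm_num [renormMap]

theorem renormMap_zero {b : ℕ} (hb : b ≠ 0) : renormMap b 0 = 0 := by simp [renormMap, hb]

theorem renormMap_mem_Ioo {b : ℕ} (hb : b ≠ 0) {x : ℝ} (hx : x ∈ Ioo (0 : ℝ) 1) :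
    renormMap b x ∈ Ioo (0 : ℝ) 1 := by
  have h := renormMap_strictMonoOn hb
  constructor
  · simpa [renormMap_zero hb] using h (left_mem_Icc.2 zero_le_one) ⟨hx.1.le, hx.2.le⟩ hx.1
  · simpa [renormMap_one] using h ⟨hx.1.le, hx.2.le⟩ (right_mem_Icc.2 zero_le_one) hx.2

theorem exists_invBranch_ofReal {b : ℕ} (hb : b ≠ 0) {v : ℝ} (hv : v ∈ Ioo (0 : ℝ) 1) :
    ∃ x ∈ Ioo (0 : ℝ) 1, invBranch b v = x ∧ renormMap b x = v := by
  have hv' : (1 : ℂ) - v = ((1 - v : ℝ) : ℂ) := by push_cast; rfl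
  have hW := (ofReal_mem_doublySlitPlane.2 hv).2
  set m := √(1 - v) with hm
  have hm0 : 0 < m := Real.sqrt_pos.2 (by linarith [hv.2])
  have hm1 : m < 1 := by rw [hm, Real.sqrt_lt' one_pos]; linarith [hv.1]
  have hk : koebeInv v = (((1 - m) / (1 + m) : ℝ) : ℂ) := by
    rw [koebeInv, hv', Complex.sqrt_of_nonneg (by exact_mod_cast (by linarith [hv.2] : 0 ≤ 1 - v))]
    simp [hm]
  have hk0 : 0 < (1 - m) / (1 + m) := div_pos (by linarith) (by linarith)
  have hh : invBranch b v = ((((1 - m) / (1 + m)) ^ ((b : ℝ)⁻¹) : ℝ) : ℂ) := by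
    rw [invBranch, hk, Complex.ofReal_cpow hk0.le]; simp
  refine ⟨_, ⟨Real.rpow_pos_of_pos hk0 _, ?_⟩, hh, ?_⟩
  · have := norm_invBranch_lt_one hb hW
    rw [hh, Complex.norm_real, Real.norm_eq_abs] at this
    exact (abs_lt.1 this).2
  · have := renormMapC_invBranch hb hW
    rw [hh, renormMapC_ofReal] at this
    exact_mod_cast this

theorem invBranch_renormMap {b : ℕ} (hb : b ≠ 0) {x : ℝ} (hx : x ∈ Ioo (0 : ℝ) 1) :
    invBranch b (renormMap b x : ℝ) = x := by
  obtain ⟨y, hy, h1, h2⟩ := exists_invBranch_ofReal hb (renormMap_mem_Ioo hb hx)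
  rw [h1, (renormMap_strictMonoOn hb).injOn ⟨hy.1.le, hy.2.le⟩ ⟨hx.1.le, hx.2.le⟩ h2]

theorem one_add_pow_ne_zero {b : ℕ} (hb : b ≠ 0) {z : ℂ} (hz : ‖z‖ < 1) : 1 + z ^ b ≠ 0 :=
  Complex.slitPlane_ne_zero (Complex.mem_slitPlane_of_norm_lt_one
    (by rw [norm_pow]; exact pow_lt_one₀ (norm_nonneg _) hz hb))

theorem differentiableAt_renormMapC {b : ℕ} (hb : b ≠ 0) {z : ℂ} (hz : ‖z‖ < 1) :
    DifferentiableAt ℂ (renormMapC b) z := by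
  unfold renormMapC
  exact DifferentiableAt.div (by fun_prop) (by fun_prop) (pow_ne_zero 2 (one_add_pow_ne_zero hb hz))

theorem differentiableAt_logTerm {b : ℕ} (hb : b ≠ 0) {z : ℂ} (hz : ‖z‖ < 1) :
    DifferentiableAt ℂ (logTerm b) z := by
  unfold logTerm
  exact DifferentiableAt.clog (by fun_prop) (Complex.mem_slitPlane_of_norm_lt_one
    (by rw [norm_pow]; exact pow_lt_one₀ (norm_nonneg _) hz hb))

/-! ### Contraction of the inverse branch at the fixed point -/

theorem abs_deriv_renormMap_le {b : ℕ} (hb : b ≠ 0) {x : ℝ} (hx : x ∈ Ioo (0 : ℝ) 1) :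
    |deriv (renormMap b) x| ≤ ‖deriv (renormMapC b) x‖ := by
  have hx1 : ‖(x : ℂ)‖ < 1 := by
    rw [Complex.norm_real, Real.norm_eq_abs, abs_of_pos hx.1]; exact hx.2
  have h := (differentiableAt_renormMapC hb hx1).hasDerivAt.real_of_complex
  simp only [renormMapC_ofReal, Complex.ofReal_re] at h
  rw [h.deriv]
  exact Complex.abs_re_le_norm _

theorem norm_deriv_invBranch_mul {b : ℕ} (hb : b ≠ 0) {t : ℝ} (ht : t ∈ Ioo (0 : ℝ) 1)
    (hfix : renormMap b t = t) :
    ‖deriv (invBranch b) t‖ * ‖deriv (renormMapC b) t‖ = 1 := by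
  have hW := ofReal_mem_doublySlitPlane.2 ht
  have ht1 : ‖(t : ℂ)‖ < 1 := by
    rw [Complex.norm_real, Real.norm_eq_abs, abs_of_pos ht.1]; exact ht.2
  have hh : invBranch b t = t := by
    simpa [hfix] using invBranch_renormMap hb ht
  have h1 := (differentiableAt_invBranch (b := b) hW).hasDerivAt
  have h2 : HasDerivAt (renormMapC b) (deriv (renormMapC b) t) (invBranch b t) := by
    rw [hh]; exact (differentiableAt_renormMapC hb ht1).hasDerivAt
  have h3 := h2.comp _ h1
  have h4 : renormMapC b ∘ invBranch b =ᶠ[𝓝 (t : ℂ)] id := by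
    filter_upwards [isOpen_doublySlitPlane.mem_nhds hW] with v hv
    exact renormMapC_invBranch hb hv.2
  have h5 := (h3.congr_of_eventuallyEq h4.symm).unique (hasDerivAt_id _)
  rw [← norm_mul, mul_comm, h5, norm_one]

/-- Near the fixed point the inverse branch contracts by a factor `q` with `2 b q ^ l < 1`. -/
theorem exists_contraction {b : ℕ} (hb : 2 ≤ b) {t : ℝ} (ht : t ∈ Ioo (0 : ℝ) 1)
    (hfix : renormMap b t = t) {l : ℕ} (hl : 2 * (b : ℝ) < deriv (renormMap b) t ^ l) :
    ∃ q δ : ℝ, 0 < q ∧ q < 1 ∧ 2 * b * q ^ l < 1 ∧ 0 < δ ∧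
      Metric.ball (t : ℂ) δ ⊆ doublySlitPlane ∧
      ∀ v ∈ Metric.ball (t : ℂ) δ, ‖invBranch b v - t‖ ≤ q * ‖v - t‖ := by
  have hb0 : b ≠ 0 := by lia
  have hW := ofReal_mem_doublySlitPlane.2 ht
  have hb2 : (2 : ℝ) ≤ b := by exact_mod_cast hb
  have hh : invBranch b t = t := by simpa [hfix] using invBranch_renormMap hb0 ht
  have h1 := norm_deriv_invBranch_mul hb0 ht hfix
  have h2 := abs_deriv_renormMap_le hb0 ht
  set d := ‖deriv (invBranch b) t‖
  set D := ‖deriv (renormMapC b) t‖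
  have hD : 2 * b < D ^ l := hl.trans_le ((le_abs_self _).trans
    ((abs_pow _ _).le.trans (pow_le_pow_left₀ (abs_nonneg _) h2 l)))
  have hd0 : 0 ≤ d := norm_nonneg _
  have hdl : 2 * b * d ^ l < 1 := by
    have h3 : d ^ l * D ^ l = 1 := by rw [← mul_pow, h1, one_pow]
    have h4 : 0 < d ^ l := by
      refine lt_of_le_of_ne (pow_nonneg hd0 l) fun h => ?_
      rw [← h, zero_mul] at h3; exact zero_ne_one h3
    nlinarith
  -- The strict inequality at `d = |h'(t)|` persists for some `q` slightly above `d`; the gap `q -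
  -- d` absorbs the error in the derivative.
  have hcont : ContinuousAt (fun q : ℝ => 2 * b * q ^ l) d := by fun_prop
  obtain ⟨q, hq, hdq⟩ := ((hcont.eventually (gt_mem_nhds hdl)).filter_mono nhdsWithin_le_nhds |>.and
    (self_mem_nhdsWithin : Ioi d ∈ 𝓝[>] d)).exists
  have hdq : d < q := hdq
  have hq0 : 0 < q := hd0.trans_lt hdq
  have hq1 : q < 1 := by
    by_contra! hc
    nlinarith [one_le_pow₀ hc (n := l)]
  have hder := (differentiableAt_invBranch (b := b) hW).hasDerivAt
  rw [hasDerivAt_iff_isLittleO] at hder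
  have hev := hder.bound (sub_pos.2 hdq)
  obtain ⟨δ, hδ, hball⟩ := Metric.eventually_nhds_iff_ball.1
    (hev.and (isOpen_doublySlitPlane.mem_nhds hW))
  refine ⟨q, δ, hq0, hq1, hq, hδ, fun v hv => (hball v hv).2, fun v hv => ?_⟩
  have h3 := (hball v hv).1
  rw [hh] at h3
  calc ‖invBranch b v - t‖
      = ‖(invBranch b v - t - (v - t) • deriv (invBranch b) t) + (v - t) • deriv (invBranch b) t‖ := by
        rw [sub_add_cancel]
    _ ≤ (q - d) * ‖v - t‖ + ‖v - t‖ * d := (norm_add_le _ _).trans (by rw [norm_smul]; gcongr)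
    _ = q * ‖v - t‖ := by ring

/-! ### Global attraction by the inverse branch -/

theorem mapsTo_iterate_invBranch {b : ℕ} (hb : 2 ≤ b) (n : ℕ) :
    MapsTo (invBranch b)^[n] doublySlitPlane doublySlitPlane :=
  MapsTo.iterate (fun _ => invBranch_mem_doublySlitPlane hb) n

theorem differentiableOn_iterate_invBranch {b : ℕ} (hb : 2 ≤ b) (n : ℕ) :
    DifferentiableOn ℂ (invBranch b)^[n] doublySlitPlane := by
  have h : DifferentiableOn ℂ (invBranch b) doublySlitPlane :=
    fun v hv => (differentiableAt_invBranch hv).differentiableWithinAt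
  exact h.iterate (fun _ => invBranch_mem_doublySlitPlane hb) n

/-- Geometric attraction to the fixed point in a ball where the inverse branch contracts. -/
theorem norm_iterate_invBranch_sub_le {b : ℕ} {t : ℂ} {q δ : ℝ} (hq0 : 0 < q) (hq1 : q < 1)
    (hc : ∀ v ∈ Metric.ball t δ, ‖invBranch b v - t‖ ≤ q * ‖v - t‖) {v : ℂ}
    (hv : v ∈ Metric.ball t δ) (n : ℕ) :
    ‖(invBranch b)^[n] v - t‖ ≤ q ^ n * ‖v - t‖ ∧ (invBranch b)^[n] v ∈ Metric.ball t δ := by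
  induction n with
  | zero => simpa using hv
  | succ n ih =>
    have h1 : ‖(invBranch b)^[n + 1] v - t‖ ≤ q ^ (n + 1) * ‖v - t‖ := by
      rw [Function.iterate_succ_apply']
      refine (hc _ ih.2).trans ?_
      rw [pow_succ', mul_assoc]
      exact mul_le_mul_of_nonneg_left ih.1 hq0.le
    refine ⟨h1, ?_⟩
    rw [mem_ball_iff_norm] at hv ⊢
    exact (h1.trans (mul_le_of_le_one_left (norm_nonneg _) (pow_le_one₀ hq0.le hq1.le))).trans_lt hv

/-- Every point of the doubly slit plane is attracted to the fixed point by the inverse branch. -/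
theorem exists_iterate_invBranch_mem_ball {b : ℕ} (hb : 2 ≤ b) {t : ℝ} (ht : t ∈ Ioo (0 : ℝ) 1)
    {q δ : ℝ} (hq0 : 0 < q) (hq1 : q < 1) (hδ : 0 < δ)
    (hc : ∀ v ∈ Metric.ball (t : ℂ) δ, ‖invBranch b v - t‖ ≤ q * ‖v - t‖)
    {v : ℂ} (hv : v ∈ doublySlitPlane) : ∃ n, (invBranch b)^[n] v ∈ Metric.ball (t : ℂ) δ := by
  have hb0 : b ≠ 0 := by lia
  -- The basin is open and nonempty, so by connectedness it suffices that it be relatively closed.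
  set B : Set ℂ := ⋃ n, doublySlitPlane ∩ (invBranch b)^[n] ⁻¹' Metric.ball (t : ℂ) δ with hB
  have hBo : IsOpen B := isOpen_iUnion fun n =>
    (differentiableOn_iterate_invBranch hb n).continuousOn.isOpen_inter_preimage
      isOpen_doublySlitPlane Metric.isOpen_ball
  have htW := ofReal_mem_doublySlitPlane.2 ht
  have htB : (t : ℂ) ∈ B := mem_iUnion.2 ⟨0, htW, Metric.mem_ball_self hδ⟩
  suffices h : doublySlitPlane ⊆ B by
    obtain ⟨n, hn⟩ := mem_iUnion.1 (h hv)
    exact ⟨n, hn.2⟩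
  refine isPreconnected_doublySlitPlane.subset_of_closure_inter_subset hBo ⟨t, htW, htB⟩ ?_
  rintro w ⟨hwB, hwW⟩
  obtain ⟨ρ, hρ, hball⟩ := Metric.isOpen_iff.1 isOpen_doublySlitPlane w hwW
  -- The second bound is chosen so that the Lipschitz constant `2 / ρ` below turns it into `δ / 2`.
  obtain ⟨u, huB, huw⟩ := Metric.mem_closure_iff.1 hwB (min ρ (ρ / 2 * (δ / 2)))
    (lt_min hρ (by positivity))
  obtain ⟨m, huW, hum⟩ := mem_iUnion.1 huB
  have htend : Tendsto (fun k : ℕ => q ^ k * ‖(invBranch b)^[m] u - t‖) atTop (𝓝 0) := by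
    simpa using (tendsto_pow_atTop_nhds_zero_of_lt_one hq0.le hq1).mul_const _
  obtain ⟨k, hk⟩ := (htend.eventually (gt_mem_nhds (half_pos hδ))).exists
  have h1 : ‖(invBranch b)^[k + 1 + m] u - t‖ < δ / 2 := by
    rw [Function.iterate_add_apply]
    refine ((norm_iterate_invBranch_sub_le hq0 hq1 hc hum (k + 1)).1.trans ?_).trans_lt hk
    exact mul_le_mul_of_nonneg_right (pow_le_pow_of_le_one hq0.le hq1.le (Nat.le_succ k))
      (norm_nonneg _)
  -- The extra `1` in `k + 1 + m` guarantees at least one application of the branch, which brings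
  -- values into the unit disc. The iterates then satisfy a Schwarz estimate with a constant
  -- independent of their order.
  have hlt : ∀ z ∈ doublySlitPlane, ‖(invBranch b)^[k + 1 + m] z‖ < 1 := fun z hz => by
    rw [show k + 1 + m = (k + m) + 1 by lia, Function.iterate_succ_apply']
    exact norm_invBranch_lt_one hb0 (mapsTo_iterate_invBranch hb (k + m) hz).2
  have h2 : dist ((invBranch b)^[k + 1 + m] u) ((invBranch b)^[k + 1 + m] w) ≤ 2 / ρ * dist u w := by
    refine Complex.dist_le_div_mul_dist_of_mapsTo_ball
      ((differentiableOn_iterate_invBranch hb _).mono hball) (fun z hz => ?_) ?_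
    · rw [mem_closedBall_iff_norm]
      exact (norm_sub_le _ _).trans (by linarith [hlt z (hball hz), hlt w hwW])
    · rw [Metric.mem_ball, dist_comm]; exact huw.trans_le (min_le_left _ _)
  refine mem_iUnion.2 ⟨k + 1 + m, hwW, ?_⟩
  rw [mem_preimage, Metric.mem_ball]
  have h3 : 2 / ρ * dist u w < δ / 2 := by
    rw [dist_comm]
    calc 2 / ρ * dist w u < 2 / ρ * (ρ / 2 * (δ / 2)) := by
          gcongr; exact huw.trans_le (min_le_right _ _)
      _ = δ / 2 := by field_simp
  rw [← dist_eq_norm] at h1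
  have h4 := dist_triangle_left ((invBranch b)^[k + 1 + m] w) (t : ℂ) ((invBranch b)^[k + 1 + m] u)
  linarith

theorem tendsto_iterate_invBranch {b : ℕ} (hb : 2 ≤ b) {t : ℝ} (ht : t ∈ Ioo (0 : ℝ) 1)
    {q δ : ℝ} (hq0 : 0 < q) (hq1 : q < 1) (hδ : 0 < δ)
    (hc : ∀ v ∈ Metric.ball (t : ℂ) δ, ‖invBranch b v - t‖ ≤ q * ‖v - t‖)
    {v : ℂ} (hv : v ∈ doublySlitPlane) :
    Tendsto (fun n => (invBranch b)^[n] v) atTop (𝓝 (t : ℂ)) := by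
  obtain ⟨m, hm⟩ := exists_iterate_invBranch_mem_ball hb ht hq0 hq1 hδ hc hv
  rw [← tendsto_add_atTop_iff_nat m, tendsto_iff_norm_sub_tendsto_zero]
  have htend : Tendsto (fun k : ℕ => q ^ k * ‖(invBranch b)^[m] v - t‖) atTop (𝓝 0) := by
    simpa using (tendsto_pow_atTop_nhds_zero_of_lt_one hq0.le hq1).mul_const _
  refine squeeze_zero (fun _ => norm_nonneg _) (fun n => ?_) htend
  rw [Function.iterate_add_apply]
  exact (norm_iterate_invBranch_sub_le hq0 hq1 hc hm n).1

/-! ### Real orbits below the fixed point -/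

/-- If `t ≤ f(t)`, monotonicity keeps the whole backward orbit of `t` at or below `t`, although it
converges to `tc > t`. -/
theorem renormMap_lt_self {b : ℕ} (hb : 2 ≤ b) {tc : ℝ} (htc : tc ∈ Ioo (0 : ℝ) 1)
    (hfix : renormMap b tc = tc) {l : ℕ} (hl : 2 * (b : ℝ) < deriv (renormMap b) tc ^ l)
    {t : ℝ} (ht : t ∈ Ioo 0 tc) : renormMap b t < t := by
  have hb0 : b ≠ 0 := by lia
  obtain ⟨q, δ, hq0, hq1, -, hδ, -, hc⟩ := exists_contraction hb htc hfix hl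
  have ht1 : t ∈ Ioo (0 : ℝ) 1 := ⟨ht.1, ht.2.trans htc.2⟩
  by_contra! hle
  have hit : ∀ n, ∃ x ∈ Ioo (0 : ℝ) 1, (invBranch b)^[n] t = x ∧ x ≤ t := by
    intro n
    induction n with
    | zero => exact ⟨t, ht1, rfl, le_rfl⟩
    | succ n ih =>
      obtain ⟨x, hx, hxe, hxt⟩ := ih
      obtain ⟨y, hy, hye, hyx⟩ := exists_invBranch_ofReal hb0 hx
      refine ⟨y, hy, by rw [Function.iterate_succ_apply', hxe, hye], ?_⟩
      rw [← (renormMap_strictMonoOn hb0).le_iff_le ⟨hy.1.le, hy.2.le⟩ ⟨ht1.1.le, ht1.2.le⟩, hyx]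
      exact hxt.trans hle
  have hlim := tendsto_iterate_invBranch hb htc hq0 hq1 hδ hc (ofReal_mem_doublySlitPlane.2 ht1)
  have h1 := (Complex.continuous_re.tendsto _).comp hlim
  have h2 : tc ≤ t := le_of_tendsto h1 (Eventually.of_forall fun n => by
    obtain ⟨x, -, hxe, hxt⟩ := hit n
    simpa [hxe] using hxt)
  exact absurd ht.2 (not_lt.2 h2)

theorem renormMap_nonneg (b : ℕ) {t : ℝ} (ht : 0 ≤ t) : 0 ≤ renormMap b t := by
  unfold renormMap; positivity

theorem contDiffAt_renormMap (b : ℕ) {t : ℝ} (ht : 0 ≤ t) : ContDiffAt ℝ ∞ (renormMap b) t := by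
  unfold renormMap
  exact ContDiffAt.div (by fun_prop) (by fun_prop) (by positivity)

/-- The orbit decreases to a fixed point in `[0, tc)`, and `0` is the only one. -/
theorem exists_iterate_renormMap_lt {b : ℕ} (hb : 2 ≤ b) {tc : ℝ} (htc : tc ∈ Ioo (0 : ℝ) 1)
    (hfix : renormMap b tc = tc) {l : ℕ} (hl : 2 * (b : ℝ) < deriv (renormMap b) tc ^ l)
    {t : ℝ} (ht : t ∈ Ico 0 tc) {ε : ℝ} (hε : 0 < ε) : ∃ n, (renormMap b)^[n] t < ε := by
  have hb0 : b ≠ 0 := by lia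
  have hle : ∀ x ∈ Ico 0 tc, renormMap b x ≤ x := by
    rintro x ⟨hx0, hx⟩
    rcases hx0.eq_or_lt with rfl | hx0
    · exact (renormMap_zero hb0).le
    · exact (renormMap_lt_self hb htc hfix hl ⟨hx0, hx⟩).le
  have hmaps : MapsTo (renormMap b) (Ico 0 tc) (Ico 0 tc) := fun x hx =>
    ⟨renormMap_nonneg b hx.1, (hle x hx).trans_lt hx.2⟩
  have hmem : ∀ n, (renormMap b)^[n] t ∈ Ico 0 tc := fun n => hmaps.iterate n ht
  have hanti : Antitone fun n => (renormMap b)^[n] t := antitone_nat_of_succ_le fun n => by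
    rw [Function.iterate_succ_apply']; exact hle _ (hmem n)
  have hbdd : BddBelow (range fun n => (renormMap b)^[n] t) :=
    ⟨0, by rintro _ ⟨n, rfl⟩; exact (hmem n).1⟩
  have hlim := tendsto_atTop_ciInf hanti hbdd
  set c := ⨅ n, (renormMap b)^[n] t
  have hc0 : 0 ≤ c := le_ciInf fun n => (hmem n).1
  have hct : c < tc := (ciInf_le hbdd 0).trans_lt ht.2
  have hfixc : renormMap b c = c :=
    isFixedPt_of_tendsto_iterate hlim (contDiffAt_renormMap b hc0).continuousAt
  have hc : c = 0 := by
    by_contra hne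
    exact (renormMap_lt_self hb htc hfix hl ⟨lt_of_le_of_ne hc0 (Ne.symm hne), hct⟩).ne hfixc
  rw [hc] at hlim
  exact (hlim.eventually (gt_mem_nhds hε)).exists

/-! ### Orbit sums and the functional equation -/

/-- The weighted sum `∑ cⁿ g (fⁿ z)` along the orbit of `z`. -/
noncomputable def orbitSum {α 𝕜 : Type*} [NormedField 𝕜] (c : 𝕜) (f : α → α) (g : α → 𝕜) (z : α) : 𝕜 :=
  ∑' n : ℕ, c ^ n * g (f^[n] z)

section OrbitSum

variable {α 𝕜 : Type*} [NormedField 𝕜] {c : 𝕜} {f : α → α} {g : α → 𝕜} {z : α}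

theorem summable_orbit_of_apply (h : Summable fun n : ℕ => c ^ n * g (f^[n] (f z))) :
    Summable fun n : ℕ => c ^ n * g (f^[n] z) := by
  rw [← summable_nat_add_iff 1]
  refine (h.mul_left c).congr fun n => ?_
  rw [pow_succ', mul_assoc, Function.iterate_succ_apply]

theorem orbitSum_eq_add (h : Summable fun n : ℕ => c ^ n * g (f^[n] (f z))) :
    orbitSum c f g z = g z + c * orbitSum c f g (f z) := by
  rw [orbitSum, orbitSum, (summable_orbit_of_apply h).tsum_eq_zero_add, ← tsum_mul_left]
  simp [pow_succ', mul_assoc]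

end OrbitSum

theorem freeEnergy_eq_orbitSum (b : ℕ) : freeEnergy b =
    orbitSum ((2 * (b : ℝ))⁻¹) (renormMap b) (fun t => Real.log (1 + t ^ b)) := by
  ext t
  simp only [freeEnergy, orbitSum, inv_pow]

theorem mapsTo_renormMap_Icc (b : ℕ) : MapsTo (renormMap b) (Icc 0 1) (Icc 0 1) := by
  intro t ht
  refine ⟨renormMap_nonneg b ht.1, ?_⟩
  have : 0 ≤ t ^ b := pow_nonneg ht.1 b
  rw [renormMap, div_le_one (by positivity)]
  nlinarith [sq_nonneg (1 - t ^ b)]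

theorem log_one_add_pow_mem_Icc (b : ℕ) {t : ℝ} (ht : t ∈ Icc (0 : ℝ) 1) :
    Real.log (1 + t ^ b) ∈ Icc (0 : ℝ) 1 := by
  have h0 : 0 ≤ t ^ b := pow_nonneg ht.1 b
  have h1 : t ^ b ≤ 1 := pow_le_one₀ ht.1 ht.2
  refine ⟨Real.log_nonneg (by linarith), ?_⟩
  have := Real.log_le_sub_one_of_pos (by linarith : 0 < 1 + t ^ b)
  linarith

theorem inv_two_mul_natCast_lt_one {b : ℕ} (hb : 2 ≤ b) : (2 * (b : ℝ))⁻¹ < 1 := by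
  have hb2 : (2 : ℝ) ≤ b := by exact_mod_cast hb
  exact inv_lt_one_of_one_lt₀ (by linarith)

theorem summable_freeEnergy {b : ℕ} (hb : 2 ≤ b) {t : ℝ} (ht : t ∈ Icc (0 : ℝ) 1) :
    Summable fun n : ℕ => (2 * (b : ℝ))⁻¹ ^ n * Real.log (1 + (renormMap b)^[n] t ^ b) := by
  have h0 : 0 ≤ (2 * (b : ℝ))⁻¹ := by positivity
  refine Summable.of_nonneg_of_le (fun n => ?_) (fun n => ?_)
    (summable_geometric_of_lt_one h0 (inv_two_mul_natCast_lt_one hb))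
  · exact mul_nonneg (pow_nonneg h0 n)
      (log_one_add_pow_mem_Icc b ((mapsTo_renormMap_Icc b).iterate n ht)).1
  · exact mul_le_of_le_one_right (pow_nonneg h0 n)
      (log_one_add_pow_mem_Icc b ((mapsTo_renormMap_Icc b).iterate n ht)).2

theorem freeEnergy_eq_add {b : ℕ} (hb : 2 ≤ b) {t : ℝ} (ht : t ∈ Icc (0 : ℝ) 1) :
    freeEnergy b t = Real.log (1 + t ^ b) + (2 * (b : ℝ))⁻¹ * freeEnergy b (renormMap b t) := by
  rw [freeEnergy_eq_orbitSum]
  exact orbitSum_eq_add (g := fun t : ℝ => Real.log (1 + t ^ b))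
    (summable_freeEnergy hb (mapsTo_renormMap_Icc b ht))

theorem freeEnergy_nonneg {b : ℕ} {t : ℝ} (ht : t ∈ Icc (0 : ℝ) 1) : 0 ≤ freeEnergy b t :=
  tsum_nonneg fun n => mul_nonneg (by positivity)
    (log_one_add_pow_mem_Icc b ((mapsTo_renormMap_Icc b).iterate n ht)).1

theorem freeEnergy_pos {b : ℕ} (hb : 2 ≤ b) {t : ℝ} (ht : t ∈ Ioc (0 : ℝ) 1) :
    0 < freeEnergy b t := by
  have ht' : t ∈ Icc (0 : ℝ) 1 := ⟨ht.1.le, ht.2⟩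
  rw [freeEnergy_eq_add hb ht']
  have h1 : 0 < Real.log (1 + t ^ b) := Real.log_pos (by linarith [pow_pos ht.1 b])
  have h2 : 0 ≤ freeEnergy b (renormMap b t) := freeEnergy_nonneg (mapsTo_renormMap_Icc b ht')
  positivity

/-! ### Holomorphy near the origin and smoothness below the fixed point -/

/-- The free energy as a function of a complex variable near the origin. -/
noncomputable def freeEnergyC (b : ℕ) : ℂ → ℂ :=
  orbitSum ((2 * (b : ℂ))⁻¹) (renormMapC b) (logTerm b)

/-- The radius `1 / 16` gives `|z^b| ≤ |z| / 16` and `|1 + z^b|^2 ≥ 1 / 4`, which exactly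
compensates the factor `4`. -/
theorem norm_renormMapC_le {b : ℕ} (hb : 2 ≤ b) {z : ℂ} (hz : z ∈ Metric.ball (0 : ℂ) (1 / 16)) :
    ‖renormMapC b z‖ ≤ ‖z‖ := by
  rw [mem_ball_zero_iff] at hz
  have h0 := norm_nonneg z
  have h1 : ‖z ^ b‖ ≤ ‖z‖ / 16 := by
    rw [norm_pow]
    calc ‖z‖ ^ b ≤ ‖z‖ ^ 2 := pow_le_pow_of_le_one h0 (by linarith) hb
      _ ≤ ‖z‖ / 16 := by nlinarith
  have h2 : 1 / 2 ≤ ‖1 + z ^ b‖ := by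
    have := norm_sub_le_norm_add (1 : ℂ) (z ^ b)
    rw [norm_one] at this
    linarith
  rw [renormMapC, norm_div, norm_mul, norm_pow (1 + z ^ b), RCLike.norm_ofNat,
    div_le_iff₀ (by positivity)]
  have h3 : 1 / 4 ≤ ‖1 + z ^ b‖ ^ 2 := by nlinarith
  nlinarith [mul_le_mul_of_nonneg_left h3 h0]

theorem mapsTo_renormMapC_ball {b : ℕ} (hb : 2 ≤ b) :
    MapsTo (renormMapC b) (Metric.ball 0 (1 / 16)) (Metric.ball 0 (1 / 16)) := fun z hz => by
  have h := norm_renormMapC_le hb hz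
  rw [mem_ball_zero_iff] at *
  exact h.trans_lt hz

theorem norm_logTerm_le {b : ℕ} (hb : b ≠ 0) {z : ℂ} (hz : z ∈ Metric.ball (0 : ℂ) (1 / 16)) :
    ‖logTerm b z‖ ≤ 1 := by
  rw [mem_ball_zero_iff] at hz
  have h1 : ‖z ^ b‖ ≤ 1 / 16 := by
    rw [norm_pow]
    exact (pow_le_of_le_one (norm_nonneg _) (by linarith) hb).trans hz.le
  exact (Complex.norm_log_one_add_half_le_self (by linarith)).trans (by linarith)

theorem norm_freeEnergyC_term_le {b : ℕ} (hb : 2 ≤ b) {z : ℂ}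
    (hz : z ∈ Metric.ball (0 : ℂ) (1 / 16)) (n : ℕ) :
    ‖(2 * (b : ℂ))⁻¹ ^ n * logTerm b ((renormMapC b)^[n] z)‖ ≤ (2 * (b : ℝ))⁻¹ ^ n := by
  rw [norm_mul, norm_pow, norm_inv, norm_mul, RCLike.norm_ofNat, RCLike.norm_natCast]
  exact mul_le_of_le_one_right (by positivity)
    (norm_logTerm_le (by lia) ((mapsTo_renormMapC_ball hb).iterate n hz))

theorem summable_freeEnergyC {b : ℕ} (hb : 2 ≤ b) {z : ℂ}
    (hz : z ∈ Metric.ball (0 : ℂ) (1 / 16)) :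
    Summable fun n : ℕ => (2 * (b : ℂ))⁻¹ ^ n * logTerm b ((renormMapC b)^[n] z) :=
  Summable.of_norm_bounded
    (summable_geometric_of_lt_one (by positivity) (inv_two_mul_natCast_lt_one hb))
    (norm_freeEnergyC_term_le hb hz)

theorem differentiableOn_freeEnergyC {b : ℕ} (hb : 2 ≤ b) :
    DifferentiableOn ℂ (freeEnergyC b) (Metric.ball 0 (1 / 16)) := by
  have hb0 : b ≠ 0 := by lia
  have hlt : ∀ z ∈ Metric.ball (0 : ℂ) (1 / 16), ‖z‖ < 1 := fun z hz => by
    rw [mem_ball_zero_iff] at hz; linarith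
  refine Complex.differentiableOn_tsum_of_summable_norm
    (summable_geometric_of_lt_one (by positivity) (inv_two_mul_natCast_lt_one hb))
    (fun n => ?_) Metric.isOpen_ball fun n z hz => norm_freeEnergyC_term_le hb hz n
  have hf : DifferentiableOn ℂ (renormMapC b) (Metric.ball 0 (1 / 16)) := fun z hz =>
    (differentiableAt_renormMapC hb0 (hlt z hz)).differentiableWithinAt
  have hg : DifferentiableOn ℂ (logTerm b) (Metric.ball 0 (1 / 16)) := fun z hz =>
    (differentiableAt_logTerm hb0 (hlt z hz)).differentiableWithinAt
  exact (hg.comp (hf.iterate (mapsTo_renormMapC_ball hb) n)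
    ((mapsTo_renormMapC_ball hb).iterate n)).const_mul _

theorem freeEnergyC_eq_add {b : ℕ} (hb : 2 ≤ b) {z : ℂ} (hz : z ∈ Metric.ball (0 : ℂ) (1 / 16)) :
    freeEnergyC b z = logTerm b z + (2 * (b : ℂ))⁻¹ * freeEnergyC b (renormMapC b z) :=
  orbitSum_eq_add (summable_freeEnergyC hb (mapsTo_renormMapC_ball hb hz))

theorem freeEnergyC_mul {b : ℕ} (hb : 2 ≤ b) {ζ z : ℂ} (hζ : ζ ^ b = 1)
    (hz : z ∈ Metric.ball (0 : ℂ) (1 / 16)) : freeEnergyC b (ζ * z) = freeEnergyC b z := by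
  have hζz : ζ * z ∈ Metric.ball (0 : ℂ) (1 / 16) := by
    rw [mem_ball_zero_iff] at *
    rwa [norm_mul, Complex.norm_eq_one_of_pow_eq_one hζ (by lia), one_mul]
  rw [freeEnergyC_eq_add hb hz, freeEnergyC_eq_add hb hζz]
  simp [logTerm, renormMapC, mul_pow, hζ]

theorem freeEnergyC_zero {b : ℕ} (hb : 2 ≤ b) : freeEnergyC b 0 = 0 := by
  have hb0 : b ≠ 0 := by lia
  have h : ∀ n, (renormMapC b)^[n] 0 = 0 := fun n =>
    Function.iterate_fixed (by simp [renormMapC, hb0]) n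
  simp [freeEnergyC, orbitSum, h, logTerm, hb0]

theorem freeEnergyC_ofReal {b : ℕ} (hb : 2 ≤ b) {x : ℝ} (hx : |x| < 1 / 16) :
    freeEnergyC b x = (freeEnergy b x : ℂ) := by
  have hb0 : b ≠ 0 := by lia
  have hit : ∀ n, (renormMapC b)^[n] x = ((renormMap b)^[n] x : ℝ) := by
    intro n
    induction n with
    | zero => rfl
    | succ n ih => rw [Function.iterate_succ_apply', ih, renormMapC_ofReal,
        Function.iterate_succ_apply']
  have hxb : (x : ℂ) ∈ Metric.ball (0 : ℂ) (1 / 16) := by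
    rwa [mem_ball_zero_iff, Complex.norm_real]
  rw [freeEnergyC, orbitSum, freeEnergy, Complex.ofReal_tsum]
  refine tsum_congr fun n => ?_
  have h1 := (mapsTo_renormMapC_ball hb).iterate n hxb
  rw [hit, mem_ball_zero_iff, Complex.norm_real, Real.norm_eq_abs] at h1
  have h2 : |(renormMap b)^[n] x ^ b| < 1 := by
    rw [abs_pow]; exact pow_lt_one₀ (abs_nonneg _) (by linarith) hb0
  rw [hit, logTerm, inv_pow, Complex.ofReal_mul, Complex.ofReal_log (by linarith [(abs_lt.1 h2).1])]
  push_cast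
  rfl

theorem contDiffAt_freeEnergy_of_abs_lt {b : ℕ} (hb : 2 ≤ b) {x : ℝ} (hx : |x| < 1 / 16) :
    ContDiffAt ℝ ∞ (freeEnergy b) x := by
  have hxb : (x : ℂ) ∈ Metric.ball (0 : ℂ) (1 / 16) := by
    rwa [mem_ball_zero_iff, Complex.norm_real]
  have h1 : ContDiffAt ℂ ∞ (freeEnergyC b) x :=
    ((differentiableOn_freeEnergyC hb).analyticAt (Metric.isOpen_ball.mem_nhds hxb)).contDiffAt
  refine h1.real_of_complex.congr_of_eventuallyEq ?_
  filter_upwards [continuous_abs.continuousAt.eventually (gt_mem_nhds hx)] with y hy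
  rw [freeEnergyC_ofReal hb hy, Complex.ofReal_re]

theorem contDiffAt_freeEnergy {b : ℕ} (hb : 2 ≤ b) {tc : ℝ} (htc : tc ∈ Ioo (0 : ℝ) 1)
    (hfix : renormMap b tc = tc) {l : ℕ} (hl : 2 * (b : ℝ) < deriv (renormMap b) tc ^ l)
    {t : ℝ} (ht : t ∈ Ico 0 tc) : ContDiffAt ℝ ∞ (freeEnergy b) t := by
  obtain ⟨n, hn⟩ := exists_iterate_renormMap_lt hb htc hfix hl ht (by norm_num : (0 : ℝ) < 1 / 16)
  induction n generalizing t with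
  | zero => exact contDiffAt_freeEnergy_of_abs_lt hb (by rw [abs_of_nonneg ht.1]; exact hn)
  | succ n ih =>
    rcases ht.1.eq_or_lt with rfl | h0
    -- The point `0` is separated because the functional equation is available only on `[0, 1]`, not
    -- on a neighbourhood of `0`.
    · exact contDiffAt_freeEnergy_of_abs_lt hb (by norm_num)
    have hft : renormMap b t ∈ Ico 0 tc := ⟨renormMap_nonneg b ht.1,
      (renormMap_lt_self hb htc hfix hl ⟨h0, ht.2⟩).trans ht.2⟩
    have h1 := (ih hft hn).comp t (contDiffAt_renormMap b ht.1)
    have h2 : ContDiffAt ℝ ∞ (fun t : ℝ => Real.log (1 + t ^ b)) t :=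
      ContDiffAt.log (by fun_prop) (by positivity)
    refine (h2.add (contDiffAt_const (c := (2 * (b : ℝ))⁻¹) |>.mul h1)).congr_of_eventuallyEq ?_
    filter_upwards [Icc_mem_nhds h0 (ht.2.trans htc.2)] with s hs
    exact freeEnergy_eq_add hb hs

/-! ### Taylor bounds at an endpoint -/

theorem exists_polynomial_derivative_eq (T : Polynomial ℝ) : ∃ P, Polynomial.derivative P = T := by
  induction T using Polynomial.induction_on' with
  | add p q hp hq =>
    obtain ⟨P, rfl⟩ := hp
    obtain ⟨Q, rfl⟩ := hq
    exact ⟨P + Q, Polynomial.derivative_add⟩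
  | monomial n a =>
    refine ⟨Polynomial.monomial (n + 1) (a / (n + 1)), ?_⟩
    rw [Polynomial.derivative_monomial]
    have : (n : ℝ) + 1 ≠ 0 := by positivity
    push_cast
    simp [this]

/-- One-sided Taylor expansion at the right endpoint `c` of an interval on which the `l`-th
derivative is bounded. -/
theorem exists_polynomial_abs_sub_le {a c M : ℝ} (hac : a < c) (l : ℕ) (D : ℕ → ℝ → ℝ)
    (hD : ∀ k < l, ∀ x ∈ Ioo a c, HasDerivAt (D k) (D (k + 1) x) x)
    (hM : ∀ x ∈ Ioo a c, |D l x| ≤ M) :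
    ∃ T : Polynomial ℝ, ∀ x ∈ Ioo a c, |D 0 x - T.eval x| ≤ M * (c - x) ^ l := by
  induction l generalizing D with
  | zero => exact ⟨0, fun x hx => by simpa using hM x hx⟩
  | succ l ih =>
    obtain ⟨T', hT'⟩ := ih (fun k => D (k + 1)) (fun k hk => hD (k + 1) (by lia)) hM
    obtain ⟨P, hP⟩ := exists_polynomial_derivative_eq T'
    have hM0 : 0 ≤ M := (abs_nonneg _).trans (hM ((a + c) / 2) ⟨by linarith, by linarith⟩)
    set v : ℝ → ℝ := fun x => D 0 x - P.eval x with hv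
    have hder : ∀ x ∈ Ioo a c, HasDerivAt v (D 1 x - T'.eval x) x := fun x hx => by
      rw [← hP]
      exact (hD 0 (by lia) x hx).sub (P.hasDerivAt x)
    have hbound : ∀ x ∈ Ioo a c, ∀ y ∈ Ioo x c, |v y - v x| ≤ M * (c - x) ^ l * (y - x) := by
      intro x hx y hy
      have hsub : Icc x y ⊆ Ioo a c := fun z hz => ⟨hx.1.trans_le hz.1, hz.2.trans_lt hy.2⟩
      have := (convex_Icc x y).norm_image_sub_le_of_norm_hasDerivWithin_le (C := M * (c - x) ^ l)
        (fun z hz => (hder z (hsub hz)).hasDerivWithinAt) (fun z hz => ?_)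
        (left_mem_Icc.2 hy.1.le) (right_mem_Icc.2 hy.1.le)
      · rwa [Real.norm_eq_abs, Real.norm_eq_abs, abs_of_pos (sub_pos.2 hy.1)] at this
      · refine (hT' z (hsub hz)).trans (mul_le_mul_of_nonneg_left ?_ hM0)
        exact pow_le_pow_left₀ (by linarith [hz.2, hy.2]) (by linarith [hz.1]) l
    have hlip : LipschitzOnWith (Real.toNNReal (M * (c - a) ^ l)) v (Ioo a c) := by
      have hK : 0 ≤ M * (c - a) ^ l := mul_nonneg hM0 (pow_nonneg (by linarith) l)
      refine LipschitzOnWith.of_dist_le_mul fun x hx y hy => ?_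
      rw [Real.coe_toNNReal _ hK, dist_eq_norm, dist_eq_norm]
      refine (convex_Ioo a c).norm_image_sub_le_of_norm_hasDerivWithin_le
        (fun z hz => (hder z hz).hasDerivWithinAt) (fun z hz => ?_) hy hx
      refine (hT' z hz).trans (mul_le_mul_of_nonneg_left ?_ hM0)
      exact pow_le_pow_left₀ (by linarith [hz.2]) (by linarith [hz.1]) l
    -- The Lipschitz bound yields a limit of `v` at `c`, which is the missing constant of
    -- integration.
    obtain ⟨g, hg, hgv⟩ := hlip.extend_real
    refine ⟨P + Polynomial.C (g c), fun x hx => ?_⟩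
    have hlim : Tendsto v (𝓝[<] c) (𝓝 (g c)) :=
      ((hg.continuous.tendsto c).mono_left nhdsWithin_le_nhds).congr' <| by
        filter_upwards [Ioo_mem_nhdsLT hac] with y hy using (hgv hy).symm
    have hle : |g c - v x| ≤ M * (c - x) ^ (l + 1) := by
      refine le_of_tendsto (hlim.sub_const _).abs ?_
      filter_upwards [Ioo_mem_nhdsLT hx.2] with y hy
      refine (hbound x hx y hy).trans ?_
      rw [pow_succ, ← mul_assoc]
      refine mul_le_mul_of_nonneg_left (by linarith [hy.2]) (mul_nonneg hM0 (pow_nonneg ?_ l))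
      linarith [hx.2]
    rw [abs_sub_comm] at hle
    simpa [hv, sub_sub] using hle

/-- An analytic function that is `O ((t - s) ^ l)` on a left real neighbourhood of `t` is
`O (‖v - t‖ ^ l)` on a complex neighbourhood. -/
theorem AnalyticAt.exists_norm_le_of_real_left {E : ℂ → ℂ} {t a C : ℝ} {l : ℕ}
    (hE : AnalyticAt ℂ E t) (hat : a < t) (h : ∀ s ∈ Ioo a t, ‖E s‖ ≤ C * (t - s) ^ l) :
    ∃ K, 0 ≤ K ∧ ∀ᶠ v in 𝓝 (t : ℂ), ‖E v‖ ≤ K * ‖v - t‖ ^ l := by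
  have hofReal : Tendsto (fun s : ℝ => (s : ℂ)) (𝓝[<] t) (𝓝 (t : ℂ)) :=
    (Complex.continuous_ofReal.tendsto t).mono_left nhdsWithin_le_nhds
  rcases le_or_gt (l : ℕ∞) (analyticOrderAt E t) with hl | hl
  · obtain ⟨g, hg, hgE⟩ := (natCast_le_analyticOrderAt hE).1 hl
    refine ⟨‖g t‖ + 1, by positivity, ?_⟩
    filter_upwards [hgE, hg.continuousAt.norm.eventually (gt_mem_nhds (lt_add_one ‖g t‖))]
      with v hv hgv
    rw [hv, norm_smul, norm_pow, mul_comm]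
    exact mul_le_mul_of_nonneg_right hgv.le (by positivity)
  -- If the order `m` were below `l`, dividing the real bound by `(t - s)^m` would force the leading
  -- coefficient `g t` to vanish.
  · exfalso
    obtain ⟨m, hm⟩ := ENat.ne_top_iff_exists.1 hl.ne_top
    obtain ⟨g, hg, hg0, hgE⟩ := hE.analyticOrderAt_eq_natCast.1 hm.symm
    rw [← hm, ENat.natCast_lt_natCast] at hl
    have h1 : Tendsto (fun s : ℝ => ‖g s‖) (𝓝[<] t) (𝓝 ‖g t‖) :=
      (hg.continuousAt.norm.tendsto).comp hofReal
    have h2 : Tendsto (fun s : ℝ => C * (t - s) ^ (l - m)) (𝓝[<] t) (𝓝 0) := by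
      have hc : ContinuousAt (fun s : ℝ => C * (t - s) ^ (l - m)) t := by fun_prop
      have := hc.tendsto.mono_left (nhdsWithin_le_nhds (s := Iio t))
      simpa [Nat.sub_ne_zero_of_lt hl] using this
    have h3 : ‖g t‖ ≤ 0 := by
      refine le_of_tendsto_of_tendsto h1 h2 ?_
      filter_upwards [hofReal.eventually hgE, Ioo_mem_nhdsLT hat] with s hs hsa
      have h4 := h s hsa
      have h5 : 0 < t - s := sub_pos.2 hsa.2
      have h6 : ‖(s : ℂ) - t‖ = t - s := by
        rw [← Complex.ofReal_sub, Complex.norm_real, Real.norm_eq_abs, abs_sub_comm, abs_of_pos h5]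
      rw [hs, norm_smul, norm_pow, h6, show l = m + (l - m) by lia, pow_add, ← mul_assoc,
        mul_comm C, mul_assoc] at h4
      simpa using le_of_mul_le_mul_left h4 (pow_pos h5 m)
    exact hg0 (norm_le_zero_iff.1 h3)

/-! ### The holomorphic solution on the doubly slit plane -/

theorem logTerm_ofReal (b : ℕ) {y : ℝ} (hy : 0 ≤ y) :
    logTerm b y = (Real.log (1 + y ^ b) : ℂ) := by
  rw [logTerm, Complex.ofReal_log (by positivity)]
  push_cast
  rfl

theorem exists_invBranch_ofReal_of_lt {b : ℕ} (hb : 2 ≤ b) {tc : ℝ} (htc : tc ∈ Ioo (0 : ℝ) 1)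
    (hfix : renormMap b tc = tc) {s : ℝ} (hs : s ∈ Ioo 0 tc) :
    ∃ y ∈ Ioo 0 tc, invBranch b s = y ∧
      freeEnergy b s = 2 * b * (freeEnergy b y - Real.log (1 + y ^ b)) := by
  have hb0 : b ≠ 0 := by lia
  have hbR : (b : ℝ) ≠ 0 := by exact_mod_cast hb0
  obtain ⟨y, hy, h1, h2⟩ := exists_invBranch_ofReal hb0 (v := s) ⟨hs.1, hs.2.trans htc.2⟩
  refine ⟨y, ⟨hy.1, ?_⟩, h1, ?_⟩
  · rw [← (renormMap_strictMonoOn hb0).lt_iff_lt ⟨hy.1.le, hy.2.le⟩ ⟨htc.1.le, htc.2.le⟩, h2, hfix]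
    exact hs.2
  · rw [freeEnergy_eq_add hb ⟨hy.1.le, hy.2.le⟩, h2]
    field_simp
    ring

theorem norm_ofReal_sub_of_lt {s t : ℝ} (h : s < t) : ‖(s : ℂ) - t‖ = t - s := by
  rw [← Complex.ofReal_sub, Complex.norm_real, Real.norm_eq_abs, abs_sub_comm,
    abs_of_pos (sub_pos.2 h)]

theorem pow_mul_mul_pow_pow {R : Type*} [CommSemiring R] (A K q x : R) (n l : ℕ) :
    A ^ n * (K * (q ^ n * x) ^ l) = K * x ^ l * (A * q ^ l) ^ n := by
  rw [mul_pow, mul_pow, ← pow_mul, ← pow_mul, mul_comm n l]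
  ring

/-- If the `l`-th derivative of the free energy is bounded on the left of `tc`, the free energy
extends from `(0, tc)` to a holomorphic solution of the functional equation on the doubly slit
plane. -/
theorem exists_holomorphic_extension {b : ℕ} (hb : 2 ≤ b) {tc : ℝ} (htc : tc ∈ Ioo (0 : ℝ) 1)
    (hfix : renormMap b tc = tc) {l : ℕ} (hl : 2 * (b : ℝ) < deriv (renormMap b) tc ^ l)
    {a M : ℝ} (ha : a ∈ Ico 0 tc)
    (hM : ∀ x ∈ Ioo a tc, |iteratedDerivWithin l (freeEnergy b) (Ioo 0 tc) x| ≤ M) :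
    ∃ G : ℂ → ℂ, DifferentiableOn ℂ G doublySlitPlane ∧
      (∀ s ∈ Ioo 0 tc, G (s : ℝ) = freeEnergy b s) ∧
      ∀ v ∈ doublySlitPlane, G v = 2 * b * (G (invBranch b v) - logTerm b (invBranch b v)) := by
  have hb0 : b ≠ 0 := by lia
  obtain ⟨q, δ, hq0, hq1, hql, hδ, hballW, hc⟩ := exists_contraction hb htc hfix hl
  have hM0 : 0 ≤ M :=
    (abs_nonneg _).trans (hM ((a + tc) / 2) ⟨by linarith [ha.2], by linarith [ha.2]⟩)
  have hsub : Ioo a tc ⊆ Ioo 0 tc := Ioo_subset_Ioo_left ha.1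
  have hsmooth : ContDiffOn ℝ ∞ (freeEnergy b) (Ioo 0 tc) := fun x hx =>
    (contDiffAt_freeEnergy hb htc hfix hl ⟨hx.1.le, hx.2⟩).contDiffWithinAt
  obtain ⟨T, hT⟩ := exists_polynomial_abs_sub_le ha.2 l
    (fun k => iteratedDerivWithin k (freeEnergy b) (Ioo 0 tc)) (fun k _ x hx => by
      have h1 := (hsmooth.differentiableOn_iteratedDerivWithin (m := k)
        (by exact_mod_cast ENat.natCast_lt_top k) isOpen_Ioo.uniqueDiffOn).hasDerivAt
        (isOpen_Ioo.mem_nhds (hsub hx))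
      rwa [← derivWithin_of_isOpen isOpen_Ioo (hsub hx), ← iteratedDerivWithin_succ] at h1) hM
  simp only [iteratedDerivWithin_zero] at hT
  set Tc : ℂ → ℂ := fun v => Polynomial.aeval v T with hTc
  have hTcr : ∀ x : ℝ, Tc x = ((T.eval x : ℝ) : ℂ) := fun x => by
    simpa using Polynomial.aeval_algebraMap_apply ℂ x T
  have hTcd : Differentiable ℂ Tc := Polynomial.differentiable_aeval T
  -- The defect of the Taylor polynomial in the functional equation. At real points it equals the
  -- defect of `T - F`, hence is `O((tc - s)^l)`.
  set E : ℂ → ℂ := fun v => 2 * b * (Tc (invBranch b v) - logTerm b (invBranch b v)) - Tc v with hE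
  have hEd : DifferentiableOn ℂ E doublySlitPlane := fun v hv => by
    have h1 := differentiableAt_invBranch (b := b) hv
    have h2 := (differentiableAt_logTerm hb0 (norm_invBranch_lt_one hb0 hv.2)).comp v h1
    have h3 := (hTcd (invBranch b v)).comp v h1
    exact (((h3.sub h2).const_mul _).sub (hTcd v)).differentiableWithinAt
  have htW := ofReal_mem_doublySlitPlane.2 htc
  have hEreal : ∀ s ∈ Ioo (max a (tc - δ)) tc, ‖E s‖ ≤ (2 * b + 1) * M * (tc - s) ^ l := by
    rintro s ⟨hs1, hs2⟩
    have hsa : s ∈ Ioo a tc := ⟨(le_max_left _ _).trans_lt hs1, hs2⟩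
    obtain ⟨y, hy, hye, hyF⟩ := exists_invBranch_ofReal_of_lt hb htc hfix (hsub hsa)
    have hsb : (s : ℂ) ∈ Metric.ball (tc : ℂ) δ := by
      rw [mem_ball_iff_norm, norm_ofReal_sub_of_lt hs2]
      linarith [(le_max_right a (tc - δ)).trans_lt hs1]
    have h1 := hc s hsb
    rw [hye, norm_ofReal_sub_of_lt hs2, norm_ofReal_sub_of_lt hy.2] at h1
    have h2 : tc - y ≤ tc - s := h1.trans (mul_le_of_le_one_left (by linarith) hq1.le)
    have hya : y ∈ Ioo a tc := ⟨by linarith [hsa.1], hy.2⟩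
    have h3 : E s = ((2 * b * (T.eval y - freeEnergy b y) - (T.eval s - freeEnergy b s) : ℝ) : ℂ) := by
      simp only [hE]
      rw [hye, hTcr, hTcr, logTerm_ofReal b hy.1.le, hyF]
      push_cast
      ring
    rw [h3, Complex.norm_real, Real.norm_eq_abs]
    have h4 := hT y hya
    have h5 := hT s hsa
    rw [abs_sub_comm] at h4 h5
    have h6 : M * (tc - y) ^ l ≤ M * (tc - s) ^ l :=
      mul_le_mul_of_nonneg_left (pow_le_pow_left₀ (by linarith [hy.2]) h2 l) hM0
    calc |2 * b * (T.eval y - freeEnergy b y) - (T.eval s - freeEnergy b s)|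
        ≤ |2 * b * (T.eval y - freeEnergy b y)| + |T.eval s - freeEnergy b s| := abs_sub _ _
      _ = 2 * b * |T.eval y - freeEnergy b y| + |T.eval s - freeEnergy b s| := by
          rw [abs_mul, abs_of_nonneg (by positivity : (0 : ℝ) ≤ 2 * b)]
      _ ≤ 2 * b * (M * (tc - s) ^ l) + M * (tc - s) ^ l := by
          gcongr
          exact h4.trans h6
      _ = (2 * b + 1) * M * (tc - s) ^ l := by ring
  obtain ⟨K, hK0, hK⟩ := (hEd.analyticAt (isOpen_doublySlitPlane.mem_nhds htW)
    ).exists_norm_le_of_real_left (max_lt ha.2 (by linarith)) hEreal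
  obtain ⟨ε, hε, hKε⟩ := Metric.eventually_nhds_iff_ball.1 hK
  set r := min ε δ with hr
  have hr0 : 0 < r := lt_min hε hδ
  have hcr : ∀ v ∈ Metric.ball (tc : ℂ) r, ‖invBranch b v - tc‖ ≤ q * ‖v - tc‖ := fun v hv =>
    hc v (Metric.ball_subset_ball (min_le_right _ _) hv)
  have hrW : Metric.ball (tc : ℂ) r ⊆ doublySlitPlane :=
    (Metric.ball_subset_ball (min_le_right _ _)).trans hballW
  have hρ0 : 0 ≤ 2 * b * q ^ l := by positivity
  have hgeom := summable_geometric_of_lt_one hρ0 hql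
  have hterm : ∀ v ∈ Metric.ball (tc : ℂ) r, ∀ n,
      ‖(2 * (b : ℂ)) ^ n * E ((invBranch b)^[n] v)‖ ≤ K * ‖v - tc‖ ^ l * (2 * b * q ^ l) ^ n := by
    intro v hv n
    have h1 := norm_iterate_invBranch_sub_le hq0 hq1 hcr hv n
    have h2 := hKε _ (Metric.ball_subset_ball (min_le_left _ _) h1.2)
    rw [norm_mul, norm_pow, norm_mul, RCLike.norm_ofNat, RCLike.norm_natCast]
    calc (2 * (b : ℝ)) ^ n * ‖E ((invBranch b)^[n] v)‖
        ≤ (2 * (b : ℝ)) ^ n * (K * (q ^ n * ‖v - tc‖) ^ l) := by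
          gcongr
          exact h2.trans (by gcongr; exact h1.1)
      _ = K * ‖v - tc‖ ^ l * (2 * b * q ^ l) ^ n := by
          exact pow_mul_mul_pow_pow _ _ _ _ _ _
  set S : ℂ → ℂ := orbitSum (2 * (b : ℂ)) (invBranch b) E with hS
  have hSd : DifferentiableOn ℂ S (Metric.ball (tc : ℂ) r) := by
    refine Complex.differentiableOn_tsum_of_summable_norm (hgeom.mul_left (K * r ^ l))
      (fun n => ?_) Metric.isOpen_ball fun n v hv => ?_
    · exact ((hEd.comp (differentiableOn_iterate_invBranch hb n)
        (mapsTo_iterate_invBranch hb n)).mono hrW).const_mul _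
    · refine (hterm v hv n).trans ?_
      rw [mem_ball_iff_norm] at hv
      gcongr
  have hSb : ∀ v ∈ Metric.ball (tc : ℂ) r,
      ‖S v‖ ≤ K * (∑' n : ℕ, (2 * b * q ^ l) ^ n) * ‖v - tc‖ ^ l := by
    intro v hv
    refine (tsum_of_norm_bounded (hgeom.hasSum.mul_left (K * ‖v - tc‖ ^ l)) (hterm v hv)).trans
      (le_of_eq (by ring))
  -- Induction on the number of steps needed to enter the ball: `S = E + 2b S ∘ h` pulls summability
  -- and differentiability back one step.
  have hmain : ∀ v ∈ doublySlitPlane, DifferentiableAt ℂ S v ∧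
      Summable fun n : ℕ => (2 * (b : ℂ)) ^ n * E ((invBranch b)^[n] v) := by
    intro v hv
    obtain ⟨n, hn⟩ := exists_iterate_invBranch_mem_ball hb htc hq0 hq1 hr0 hcr hv
    induction n generalizing v with
    | zero => exact ⟨hSd.differentiableAt (Metric.isOpen_ball.mem_nhds hn),
        Summable.of_norm_bounded (hgeom.mul_left _) (hterm v hn)⟩
    | succ n ih =>
      have hmem : ∀ᶠ w in 𝓝 v, w ∈ doublySlitPlane ∧ (invBranch b)^[n + 1] w ∈ Metric.ball (tc : ℂ) r :=
        ((differentiableOn_iterate_invBranch hb (n + 1)).continuousOn.isOpen_inter_preimage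
          isOpen_doublySlitPlane Metric.isOpen_ball).mem_nhds ⟨hv, hn⟩
      have h1 := ih _ (invBranch_mem_doublySlitPlane hb hv) hn
      refine ⟨?_, summable_orbit_of_apply h1.2⟩
      have h2 : DifferentiableAt ℂ (fun w => E w + 2 * b * S (invBranch b w)) v :=
        (hEd.differentiableAt (isOpen_doublySlitPlane.mem_nhds hv)).add
          ((h1.1.comp v (differentiableAt_invBranch hv)).const_mul _)
      refine h2.congr_of_eventuallyEq ?_
      filter_upwards [hmem] with w hw
      exact orbitSum_eq_add (ih _ (invBranch_mem_doublySlitPlane hb hw.1) hw.2).2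
  have hSeq : ∀ v ∈ doublySlitPlane, S v = E v + 2 * b * S (invBranch b v) := fun v hv =>
    orbitSum_eq_add (hmain _ (invBranch_mem_doublySlitPlane hb hv)).2
  have hGeq : ∀ v ∈ doublySlitPlane, Tc v + S v = 2 * b *
      (Tc (invBranch b v) + S (invBranch b v) - logTerm b (invBranch b v)) := fun v hv => by
    rw [hSeq v hv]
    simp only [hE]
    ring
  refine ⟨fun v => Tc v + S v, fun v hv => ((hTcd v).add (hmain v hv).1).differentiableWithinAt,
    fun s hs => ?_, hGeq⟩
  have hsW : ∀ x ∈ Ioo 0 tc, (x : ℂ) ∈ doublySlitPlane := fun x hx =>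
    ofReal_mem_doublySlitPlane.2 ⟨hx.1, hx.2.trans htc.2⟩
  -- The difference of two solutions satisfies `d = (2b)^n d ∘ h^n` on `(0, tc)`. As `d = O(|y -
  -- tc|^l)` near `tc`, the right side is `O((2b q^l)^n)`, so `d` vanishes.
  set d : ℂ → ℂ := fun v => freeEnergy b v.re - (Tc v + S v) with hd
  have hit : ∀ n, ∃ y ∈ Ioo 0 tc, (invBranch b)^[n] s = (y : ℂ) ∧
      d s = (2 * (b : ℂ)) ^ n * d ((invBranch b)^[n] s) := by
    intro n
    induction n with
    | zero => exact ⟨s, hs, rfl, by simp⟩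
    | succ n ih =>
      obtain ⟨x, hx, hxe, hdx⟩ := ih
      obtain ⟨y, hy, hye, hyF⟩ := exists_invBranch_ofReal_of_lt hb htc hfix hx
      refine ⟨y, hy, by rw [Function.iterate_succ_apply', hxe, hye], ?_⟩
      rw [hdx, Function.iterate_succ_apply', hxe, pow_succ, mul_assoc]
      congr 1
      simp only [hd]
      rw [hGeq x (hsW x hx), hye, logTerm_ofReal b hy.1.le]
      simp only [Complex.ofReal_re]
      rw [hyF]
      push_cast
      ring
  obtain ⟨m, hm⟩ := exists_iterate_invBranch_mem_ball hb htc hq0 hq1 hr0 hcr (hsW s hs)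
  set C := M + K * (∑' n : ℕ, (2 * b * q ^ l) ^ n) with hC
  have htail : ∀ᶠ n : ℕ in atTop, ‖d s‖ ≤ (2 * b) ^ m * (C * r ^ l) * (2 * b * q ^ l) ^ n := by
    have hlim := tendsto_iterate_invBranch hb htc hq0 hq1 hr0 hcr (hsW s hs)
    have hlim' : Tendsto (fun n => ((invBranch b)^[n + m] (s : ℂ)).re) atTop (𝓝 tc) :=
      (Complex.continuous_re.tendsto _).comp ((tendsto_add_atTop_iff_nat m).2 hlim)
    filter_upwards [hlim'.eventually (lt_mem_nhds ha.2)] with n hn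
    obtain ⟨y, hy, hye, hdy⟩ := hit (n + m)
    have h1 := norm_iterate_invBranch_sub_le hq0 hq1 hcr hm n
    rw [← Function.iterate_add_apply] at h1
    rw [hye] at hn h1 hdy
    rw [Complex.ofReal_re] at hn
    have h2 := hT y ⟨hn, hy.2⟩
    have h3 := hSb y h1.2
    have h4 : d y = ((freeEnergy b y - T.eval y : ℝ) : ℂ) - S y := by
      simp only [hd, hTcr, Complex.ofReal_re]
      push_cast
      ring
    have h5 : ‖d y‖ ≤ C * ‖(y : ℂ) - tc‖ ^ l := by
      rw [h4, hC, add_mul]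
      refine (norm_sub_le _ _).trans (add_le_add ?_ h3)
      rw [Complex.norm_real, Real.norm_eq_abs, norm_ofReal_sub_of_lt hy.2]
      exact h2
    have hC0 : 0 ≤ C := add_nonneg hM0 (mul_nonneg hK0 (tsum_nonneg fun n => pow_nonneg hρ0 n))
    rw [mem_ball_iff_norm] at hm
    rw [hdy, norm_mul, norm_pow, norm_mul, RCLike.norm_ofNat, RCLike.norm_natCast]
    calc (2 * (b : ℝ)) ^ (n + m) * ‖d y‖
        ≤ (2 * (b : ℝ)) ^ (n + m) * (C * (q ^ n * r) ^ l) := by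
          gcongr
          refine h5.trans ?_
          gcongr
          exact h1.1.trans (by gcongr)
      _ = (2 * b) ^ m * (C * r ^ l) * (2 * b * q ^ l) ^ n := by
          rw [pow_add, mul_comm (_ ^ n), mul_assoc, pow_mul_mul_pow_pow, ← mul_assoc]
  have hzero : ‖d s‖ ≤ 0 := by
    refine ge_of_tendsto ?_ htail
    simpa using (tendsto_pow_atTop_nhds_zero_of_lt_one hρ0 hql).const_mul
      ((2 * (b : ℝ)) ^ m * (C * r ^ l))
  have := norm_le_zero_iff.1 hzero
  simp only [hd, Complex.ofReal_re] at this
  exact (sub_eq_zero.1 this).symm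

/-! ### Continuation to an entire function -/

theorem exists_differentiableOn_union {U V : Set ℂ} {f g : ℂ → ℂ} (hU : IsOpen U) (hV : IsOpen V)
    (hf : DifferentiableOn ℂ f U) (hg : DifferentiableOn ℂ g V) (hfg : EqOn f g (U ∩ V)) :
    ∃ F : ℂ → ℂ, DifferentiableOn ℂ F (U ∪ V) ∧ EqOn F f U ∧ EqOn F g V := by
  classical
  have h1 : EqOn (U.piecewise f g) f U := fun z hz => piecewise_eq_of_mem _ _ _ hz
  have h2 : EqOn (U.piecewise f g) g V := fun z hz => by
    by_cases hzU : z ∈ U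
    · rw [h1 hzU, hfg ⟨hzU, hz⟩]
    · exact piecewise_eq_of_notMem _ _ _ hzU
  exact ⟨_, (hf.congr h1).union_of_isOpen (hg.congr h2) hU hV, h1, h2⟩

theorem DifferentiableOn.eqOn_of_isPreconnected {U : Set ℂ} {f g : ℂ → ℂ} (hU : IsOpen U)
    (hf : DifferentiableOn ℂ f U) (hg : DifferentiableOn ℂ g U) (hc : IsPreconnected U) {z : ℂ}
    (hz : z ∈ U) (hfg : f =ᶠ[𝓝 z] g) : EqOn f g U :=
  (hf.analyticOnNhd hU).eqOn_of_preconnected_of_eventuallyEq (hg.analyticOnNhd hU) hc hz hfg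

theorem isPreconnected_ball_inter {S : Set ℂ} {r x : ℝ} (hS : StarConvex ℝ (x : ℂ) S)
    (hx : (x : ℂ) ∈ S) (hxr : (x : ℂ) ∈ Metric.ball (0 : ℂ) r) :
    IsPreconnected (Metric.ball (0 : ℂ) r ∩ S) :=
  ((((convex_ball (0 : ℂ) r).starConvex hxr).inter hS).isPathConnected
    ⟨hxr, hx⟩).isConnected.isPreconnected

theorem starConvex_neg_slitPlane {x : ℝ} (hx : x < 0) :
    StarConvex ℝ (x : ℂ) {z | -z ∈ Complex.slitPlane} := by
  intro z hz s t hs ht hst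
  have h := Complex.starConvex_ofReal_slitPlane (neg_pos.2 hx) hz hs ht hst
  simp only [Complex.real_smul, mem_ofPred_eq] at h ⊢
  convert h using 1
  push_cast
  ring

theorem isOpen_neg_slitPlane : IsOpen {z : ℂ | -z ∈ Complex.slitPlane} :=
  Complex.isOpen_slitPlane.preimage continuous_neg

theorem isOpen_one_sub_slitPlane : IsOpen {z : ℂ | 1 - z ∈ Complex.slitPlane} :=
  Complex.isOpen_slitPlane.preimage (continuous_const.sub continuous_id)

theorem im_ne_zero_of_mem_of_neg_mem {z : ℂ} (h1 : z ∈ Complex.slitPlane)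
    (h2 : -z ∈ Complex.slitPlane) : z.im ≠ 0 := by
  intro h
  rw [Complex.mem_slitPlane_iff] at h1 h2
  simp [h] at h1 h2
  linarith

/-- A solution of the functional equation on the doubly slit plane that agrees with the free energy
near the origin extends across the negative real axis and the origin. -/
theorem exists_extension_one_sub_slitPlane {b : ℕ} (hb : 2 ≤ b) {G : ℂ → ℂ}
    (hGd : DifferentiableOn ℂ G doublySlitPlane) (hGB : EqOn (freeEnergyC b) G
      (Metric.ball 0 (1 / 16) ∩ doublySlitPlane))
    (hGeq : ∀ v ∈ doublySlitPlane,
      G v = 2 * b * (G (invBranch b v) - logTerm b (invBranch b v))) :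
    ∃ F : ℂ → ℂ, DifferentiableOn ℂ F {z | 1 - z ∈ Complex.slitPlane} ∧
      EqOn F G doublySlitPlane ∧ EqOn F (freeEnergyC b) (Metric.ball 0 (1 / 16)) := by
  have hb0 : b ≠ 0 := by lia
  set X : Set ℂ := {z | -z ∈ Complex.slitPlane} with hX
  set B : Set ℂ := Metric.ball 0 (1 / 16) with hB
  -- The functional equation with the continued branch defines a candidate across the negative axis,
  -- since that branch takes values in the upper half plane, where `G` is holomorphic.
  set H : ℂ → ℂ := fun v => 2 * b * (G (invBranchNeg b v) - logTerm b (invBranchNeg b v)) with hH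
  have hBd := differentiableOn_freeEnergyC hb
  have hHd : DifferentiableOn ℂ H X := fun v hv => by
    have h1 := differentiableAt_invBranchNeg (b := b) hv
    have h2 := hGd.differentiableAt (isOpen_doublySlitPlane.mem_nhds
      (mem_doublySlitPlane_of_im_ne_zero (invBranchNeg_im_pos hb hv).ne'))
    have h3 := differentiableAt_logTerm hb0
      (norm_invBranchNeg_lt_one hb0 (one_sub_mem_slitPlane_of_neg_mem hv))
    exact (((h2.comp v h1).sub (h3.comp v h1)).const_mul _).differentiableWithinAt
  have hupper : EqOn G H {z | 0 < z.im} := fun v hv => by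
    rw [hGeq v (mem_doublySlitPlane_of_im_ne_zero hv.ne')]
    simp only [hH, invBranchNeg_eq_invBranch b hv]
  have hXim : ∀ z : ℂ, z.im ≠ 0 → z ∈ X := fun z hz =>
    Complex.mem_slitPlane_iff.2 (Or.inr (by simpa using hz))
  have hxB : ((-1 / 32 : ℝ) : ℂ) ∈ B := by
    rw [hB, mem_ball_zero_iff, Complex.norm_real, Real.norm_eq_abs]; norm_num [abs_lt]
  have hxX : ((-1 / 32 : ℝ) : ℂ) ∈ X := by
    rw [hX, mem_ofPred_eq, Complex.neg_ofReal_mem_slitPlane]; norm_num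
  have hIB : Complex.I / 32 ∈ B := by
    rw [hB, mem_ball_zero_iff, norm_div, Complex.norm_I, RCLike.norm_ofNat]; norm_num
  have hIB' : -(Complex.I / 32) ∈ B := by
    rw [hB, mem_ball_zero_iff, norm_neg]; rwa [hB, mem_ball_zero_iff] at hIB
  have hIim : 0 < (Complex.I / 32).im := by simp
  have hBX : EqOn (freeEnergyC b) H (B ∩ X) := by
    refine DifferentiableOn.eqOn_of_isPreconnected (Metric.isOpen_ball.inter isOpen_neg_slitPlane)
      (hBd.mono inter_subset_left) (hHd.mono inter_subset_right)
      (isPreconnected_ball_inter (starConvex_neg_slitPlane (by norm_num)) hxX hxB)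
      (z := Complex.I / 32) ⟨hIB, hXim _ hIim.ne'⟩ ?_
    filter_upwards [Metric.isOpen_ball.mem_nhds hIB,
      (isOpen_lt continuous_const Complex.continuous_im).mem_nhds hIim] with z hz hz'
    rw [hGB ⟨hz, mem_doublySlitPlane_of_im_ne_zero hz'.ne'⟩, hupper hz']
  -- Below the axis the two branches differ, so agreement is not formal: both sides equal
  -- `freeEnergyC` near `-i / 32`, and the identity theorem does the rest.
  have hlower : EqOn G H {z | z.im < 0} := by
    have hopen : IsOpen {z : ℂ | z.im < 0} := isOpen_lt Complex.continuous_im continuous_const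
    have him : (-(Complex.I / 32)).im < 0 := by simp
    refine DifferentiableOn.eqOn_of_isPreconnected hopen
      (hGd.mono fun z hz => mem_doublySlitPlane_of_im_ne_zero (ne_of_lt hz))
      (hHd.mono fun z hz => hXim z (ne_of_lt hz))
      (convex_halfSpace_im_lt 0).isPreconnected (z := -(Complex.I / 32)) him ?_
    filter_upwards [Metric.isOpen_ball.mem_nhds hIB', hopen.mem_nhds him] with z hz hz'
    rw [← hGB ⟨hz, mem_doublySlitPlane_of_im_ne_zero (ne_of_lt hz')⟩,
      hBX ⟨hz, hXim z (ne_of_lt hz')⟩]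
  have hWX : EqOn G H (doublySlitPlane ∩ X) := fun z hz => by
    rcases lt_or_gt_of_ne (im_ne_zero_of_mem_of_neg_mem hz.1.1 hz.2) with h | h
    · exact hlower h
    · exact hupper h
  obtain ⟨F₁, hF₁d, hF₁G, hF₁H⟩ :=
    exists_differentiableOn_union isOpen_doublySlitPlane isOpen_neg_slitPlane hGd hHd hWX
  have hF₁B : EqOn F₁ (freeEnergyC b) ((doublySlitPlane ∪ X) ∩ B) := by
    rintro z ⟨hz | hz, hzB⟩
    · rw [hF₁G hz, hGB ⟨hzB, hz⟩]
    · rw [hF₁H hz, hBX ⟨hzB, hz⟩]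
  obtain ⟨F, hFd, hF1, hFB⟩ := exists_differentiableOn_union
    (isOpen_doublySlitPlane.union isOpen_neg_slitPlane) Metric.isOpen_ball hF₁d hBd hF₁B
  refine ⟨F, hFd.mono fun z hz => ?_, fun z hz => (hF1 (Or.inl hz)).trans (hF₁G hz), hFB⟩
  by_cases hz0 : z = 0
  · right; simp [hz0]
  · left
    rcases Complex.mem_slitPlane_or_neg_mem_slitPlane hz0 with h | h
    · exact Or.inl ⟨h, hz⟩
    · exact Or.inr h

/-- The rotational symmetry of the free energy turns an extension to the plane slit along `[1, ∞)`
into an entire function. -/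
theorem exists_entire_extension {b : ℕ} (hb : 2 ≤ b) {F : ℂ → ℂ}
    (hFd : DifferentiableOn ℂ F {z | 1 - z ∈ Complex.slitPlane})
    (hFB : EqOn F (freeEnergyC b) (Metric.ball 0 (1 / 16))) :
    ∃ Φ : ℂ → ℂ, Differentiable ℂ Φ ∧ EqOn Φ F {z | 1 - z ∈ Complex.slitPlane} := by
  have hb0 : b ≠ 0 := by lia
  set V : Set ℂ := {z | 1 - z ∈ Complex.slitPlane} with hV
  have hprim := Complex.isPrimitiveRoot_exp b hb0
  set ζ := Complex.exp (2 * Real.pi * Complex.I / b)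
  have hζb : ζ ^ b = 1 := hprim.pow_eq_one
  have hζ1 : ζ ≠ 1 := hprim.ne_one (by lia)
  have hζn : ‖ζ‖ = 1 := Complex.norm_eq_one_of_pow_eq_one hζb hb0
  have hVo : IsOpen V := isOpen_one_sub_slitPlane
  have hmul : Continuous fun z : ℂ => ζ * z := by fun_prop
  set V' : Set ℂ := (fun z => ζ * z) ⁻¹' V with hV'
  have hV'o : IsOpen V' := hVo.preimage hmul
  have hF'd : DifferentiableOn ℂ (fun z => F (ζ * z)) V' :=
    hFd.comp (by fun_prop) (fun z hz => hz)
  have h0V : (0 : ℂ) ∈ V := by simp [hV]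
  have h0V' : (0 : ℂ) ∈ V' := by simp [hV', hV]
  have hstarV : StarConvex ℝ (0 : ℂ) V := by
    simpa using starConvex_one_sub_slitPlane (x := 0) zero_lt_one
  have hstarV' : StarConvex ℝ (0 : ℂ) V' := by
    intro z hz s t hs ht hst
    have := hstarV hz hs ht hst
    simp only [hV', mem_preimage, smul_zero, zero_add, Complex.real_smul] at this ⊢
    rwa [mul_left_comm]
  have heq : EqOn F (fun z => F (ζ * z)) (V ∩ V') := by
    refine DifferentiableOn.eqOn_of_isPreconnected (hVo.inter hV'o) (hFd.mono inter_subset_left)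
      (hF'd.mono inter_subset_right)
      ((hstarV.inter hstarV').isPathConnected ⟨h0V, h0V'⟩).isConnected.isPreconnected
      (z := 0) ⟨h0V, h0V'⟩ ?_
    filter_upwards [Metric.ball_mem_nhds (0 : ℂ) (by norm_num : (0 : ℝ) < 1 / 16)] with z hz
    have hζz : ζ * z ∈ Metric.ball (0 : ℂ) (1 / 16) := by
      rw [mem_ball_zero_iff] at *
      rwa [norm_mul, hζn, one_mul]
    rw [hFB hz, hFB hζz, freeEnergyC_mul hb hζb hz]
  obtain ⟨Φ, hΦd, hΦF, -⟩ := exists_differentiableOn_union hVo hV'o hFd hF'd heq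
  refine ⟨Φ, ?_, hΦF⟩
  -- A point outside both sets would have `z` and `ζ z` both positive real of equal modulus, forcing
  -- `ζ = 1`.
  have huniv : V ∪ V' = univ := by
    have hreal : ∀ z : ℂ, z ∉ V → z = (‖z‖ : ℂ) ∧ z ≠ 0 := by
      intro z hz
      rw [hV, mem_ofPred_eq, Complex.mem_slitPlane_iff, not_or, not_lt, not_not] at hz
      simp at hz
      have h1 : z = (z.re : ℂ) := Complex.ext rfl (by simpa using hz.2)
      refine ⟨?_, fun h => by simp [h] at hz; linarith⟩
      rw [h1, Complex.norm_real, Real.norm_eq_abs, abs_of_pos (by linarith)]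
    refine eq_univ_of_forall fun z => ?_
    by_contra hz
    rw [mem_union, not_or] at hz
    obtain ⟨h1, h2⟩ := hreal z hz.1
    obtain ⟨h3, -⟩ := hreal (ζ * z) hz.2
    rw [norm_mul, hζn, one_mul, ← h1] at h3
    exact hζ1 (mul_right_cancel₀ h2 (h3.trans (one_mul z).symm))
  rw [huniv] at hΦd
  exact differentiableOn_univ.1 hΦd

/-! ### Growth estimate and the contradiction -/

theorem norm_log_two_div_le {m : ℂ} (hm : 0 < m.re) :
    ‖Complex.log (2 / (1 + m))‖ ≤ 1 + ‖m‖ + Real.pi := by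
  have h1 : 1 ≤ ‖1 + m‖ := by
    have := Complex.re_le_norm (1 + m)
    simp at this
    linarith
  have h2 : ‖1 + m‖ ≤ 1 + ‖m‖ := (norm_add_le _ _).trans (by simp)
  have h3 := Real.log_nonneg h1
  have h4 := Real.log_le_sub_one_of_pos (one_pos.trans_le h1)
  have h5 := Real.log_le_sub_one_of_pos (x := 2) two_pos
  have h6 : 0 ≤ Real.log 2 := Real.log_nonneg one_le_two
  refine (Complex.norm_le_abs_re_add_abs_im _).trans (add_le_add ?_ ?_)
  · rw [Complex.log_re, norm_div, RCLike.norm_ofNat, Real.log_div two_ne_zero (by linarith), abs_le]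
    have := norm_nonneg m
    constructor <;> linarith
  · rw [Complex.log_im]
    exact Complex.abs_arg_le_pi _

theorem dense_im_ne_zero : Dense {z : ℂ | z.im ≠ 0} :=
  (dense_compl_singleton (0 : ℝ)).preimage Complex.isOpenMap_im

/-- An entire function growing at most like a square root is constant. -/
theorem Differentiable.eq_of_norm_le_sqrt {Φ : ℂ → ℂ} (hΦ : Differentiable ℂ Φ) {A C : ℝ}
    (hC : 0 ≤ C) (h : ∀ z, ‖Φ z‖ ≤ A + C * √(1 + ‖z‖)) (z w : ℂ) : Φ z = Φ w := by
  refine is_const_of_deriv_eq_zero hΦ (fun c => ?_) z w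
  have hlim : Tendsto (fun R : ℝ => (A + C * (√(1 + ‖c‖) + √R)) / R) atTop (𝓝 0) := by
    have h1 : Tendsto (fun R : ℝ => (A + C * √(1 + ‖c‖)) / R) atTop (𝓝 0) :=
      tendsto_const_nhds.div_atTop tendsto_id
    have h2 : Tendsto (fun R : ℝ => C / √R) atTop (𝓝 0) :=
      tendsto_const_nhds.div_atTop Real.tendsto_sqrt_atTop
    have h3 := h1.add h2
    rw [add_zero] at h3
    refine h3.congr' ?_
    filter_upwards [eventually_gt_atTop 0] with R hR
    have h4 := Real.sq_sqrt hR.le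
    have h5 := Real.sqrt_pos.2 hR
    field_simp
    linear_combination -C * h4
  refine norm_le_zero_iff.1 (ge_of_tendsto hlim ?_)
  filter_upwards [eventually_gt_atTop 0] with R hR
  refine Complex.norm_deriv_le_of_forall_mem_sphere_norm_le hR hΦ.diffContOnCl fun z hz => ?_
  refine (h z).trans ?_
  have h1 : ‖z‖ ≤ ‖c‖ + R := by
    rw [mem_sphere_iff_norm] at hz
    have := norm_sub_norm_le z c
    linarith
  have h2 : √(1 + ‖z‖) ≤ √(1 + ‖c‖) + √R :=
    Real.sqrt_le_iff.2 ⟨by positivity, by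
      nlinarith [Real.sq_sqrt (by positivity : 0 ≤ 1 + ‖c‖), Real.sq_sqrt hR.le,
        mul_nonneg (Real.sqrt_nonneg (1 + ‖c‖)) (Real.sqrt_nonneg R)]⟩
  gcongr

/-- The free energy near the origin has no holomorphic extension to the doubly slit plane that
satisfies the functional equation. -/
theorem not_eqOn_holomorphic_solution {b : ℕ} (hb : 2 ≤ b) {G : ℂ → ℂ}
    (hGd : DifferentiableOn ℂ G doublySlitPlane)
    (hGeq : ∀ v ∈ doublySlitPlane,
      G v = 2 * b * (G (invBranch b v) - logTerm b (invBranch b v))) :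
    ¬ EqOn (freeEnergyC b) G (Metric.ball 0 (1 / 16) ∩ doublySlitPlane) := by
  intro hGB
  have hb0 : b ≠ 0 := by lia
  obtain ⟨F, hFd, hFG, hFB⟩ := exists_extension_one_sub_slitPlane hb hGd hGB hGeq
  obtain ⟨Φ, hΦd, hΦF⟩ := exists_entire_extension hb hFd hFB
  have hΦG : EqOn Φ G doublySlitPlane := fun z hz => (hΦF hz.2).trans (hFG hz)
  have hΦB : EqOn Φ (freeEnergyC b) (Metric.ball 0 (1 / 16)) := fun z hz => by
    refine (hΦF (one_sub_mem_slitPlane_of_norm_lt_one ?_)).trans (hFB hz)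
    rw [mem_ball_zero_iff] at hz
    linarith
  -- In the functional equation `Φ` is evaluated only inside the unit disc, where compactness bounds
  -- it.
  obtain ⟨A, hA⟩ := (isCompact_closedBall (0 : ℂ) 1).exists_bound_of_continuousOn
    hΦd.continuous.continuousOn
  have hgrowthW : ∀ v ∈ doublySlitPlane,
      ‖Φ v‖ ≤ 2 * b * (A + 1 + Real.pi) + 2 * b * √(1 + ‖v‖) := by
    intro v hv
    have h1 := hA (invBranch b v) (by
      rw [mem_closedBall_zero_iff]; exact (norm_invBranch_lt_one hb0 hv.2).le)
    have h2 : ‖logTerm b (invBranch b v)‖ ≤ 1 + √(1 + ‖v‖) + Real.pi := by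
      rw [logTerm, invBranch_pow hb0, one_add_koebeInv hv.2]
      refine (norm_log_two_div_le (sqrt_re_pos hv.2)).trans ?_
      gcongr
      refine Real.le_sqrt_of_sq_le ?_
      rw [← norm_pow, sqrt_sq]
      exact (norm_sub_le _ _).trans (by simp)
    rw [hΦG hv, hGeq v hv, ← hΦG (invBranch_mem_doublySlitPlane hb hv), norm_mul, norm_mul,
      RCLike.norm_ofNat, RCLike.norm_natCast, ← mul_add]
    refine mul_le_mul_of_nonneg_left ?_ (by positivity)
    exact (norm_sub_le _ _).trans (by linarith)
  -- The bound passes to the slits by continuity, as the nonreal points are dense.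
  have hgrowth : ∀ v, ‖Φ v‖ ≤ 2 * b * (A + 1 + Real.pi) + 2 * b * √(1 + ‖v‖) := by
    have hclosed : IsClosed {v | ‖Φ v‖ ≤ 2 * b * (A + 1 + Real.pi) + 2 * b * √(1 + ‖v‖)} :=
      isClosed_le hΦd.continuous.norm (by fun_prop)
    intro v
    exact hclosed.closure_subset_iff.2
      (fun z hz => hgrowthW z (mem_doublySlitPlane_of_im_ne_zero hz)) (dense_im_ne_zero v)
  have hconst := hΦd.eq_of_norm_le_sqrt (by positivity) hgrowth ((1 / 32 : ℝ) : ℂ) 0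
  have hx : |(1 / 32 : ℝ)| < 1 / 16 := by norm_num [abs_lt]
  rw [hΦB (by rwa [mem_ball_zero_iff, Complex.norm_real]), hΦB (by simp), freeEnergyC_zero hb,
    freeEnergyC_ofReal hb hx] at hconst
  exact (freeEnergy_pos (t := 1 / 32) hb (by norm_num)).ne' (by exact_mod_cast hconst)

theorem eqOn_freeEnergyC_of_eq_ofReal {b : ℕ} (hb : 2 ≤ b) {tc : ℝ} (htc : 0 < tc) {G : ℂ → ℂ}
    (hGd : DifferentiableOn ℂ G doublySlitPlane)
    (hGF : ∀ s ∈ Ioo 0 tc, G (s : ℝ) = freeEnergy b s) :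
    EqOn (freeEnergyC b) G (Metric.ball 0 (1 / 16) ∩ doublySlitPlane) := by
  set r := min tc (1 / 16) with hr
  have hr0 : 0 < r := lt_min htc (by norm_num)
  have hr16 : r ≤ 1 / 16 := min_le_right _ _
  have hx : r / 2 ∈ Ioo 0 r := ⟨by linarith, by linarith⟩
  have hx1 : r / 2 ∈ Ioo (0 : ℝ) 1 := ⟨hx.1, by linarith⟩
  have hxW := ofReal_mem_doublySlitPlane.2 hx1
  have hxB : ((r / 2 : ℝ) : ℂ) ∈ Metric.ball (0 : ℂ) (1 / 16) := by
    rw [mem_ball_zero_iff, Complex.norm_real, Real.norm_eq_abs, abs_of_pos hx.1]; linarith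
  have hopen := (Metric.isOpen_ball (x := (0 : ℂ)) (ε := 1 / 16)).inter isOpen_doublySlitPlane
  refine (((differentiableOn_freeEnergyC hb).mono inter_subset_left).analyticOnNhd
    hopen).eqOn_of_preconnected_of_frequently_eq ((hGd.mono inter_subset_right).analyticOnNhd hopen)
    (isPreconnected_ball_inter (starConvex_doublySlitPlane hx1) hxW hxB) ⟨hxB, hxW⟩ ?_
  have htend : Tendsto (fun s : ℝ => (s : ℂ)) (𝓝[≠] (r / 2)) (𝓝[≠] ((r / 2 : ℝ) : ℂ)) :=
    tendsto_nhdsWithin_of_tendsto_nhds_of_eventually_within _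
      ((Complex.continuous_ofReal.tendsto _).mono_left nhdsWithin_le_nhds)
      (by filter_upwards [self_mem_nhdsWithin] with s hs using fun h => hs (Complex.ofReal_injective h))
  refine htend.frequently (Eventually.frequently ?_)
  filter_upwards [nhdsWithin_le_nhds (Ioo_mem_nhds hx.1 hx.2)] with s hs
  rw [hGF s ⟨hs.1, hs.2.trans_le (min_le_left _ _)⟩, freeEnergyC_ofReal hb]
  rw [abs_of_pos hs.1]
  exact hs.2.trans_le hr16

/-- The `l`-th derivative of the free energy is unbounded on every left neighbourhood of `tc`. -/
theorem exists_lt_abs_iteratedDerivWithin_freeEnergy {b : ℕ} (hb : 2 ≤ b) {tc : ℝ}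
    (htc : tc ∈ Ioo (0 : ℝ) 1) (hfix : renormMap b tc = tc) {l : ℕ}
    (hl : 2 * (b : ℝ) < deriv (renormMap b) tc ^ l) {a : ℝ} (ha : a ∈ Ico 0 tc) (M : ℝ) :
    ∃ x ∈ Ioo a tc, M < |iteratedDerivWithin l (freeEnergy b) (Ioo 0 tc) x| := by
  by_contra! hM
  obtain ⟨G, hGd, hGF, hGeq⟩ := exists_holomorphic_extension hb htc hfix hl ha hM
  exact not_eqOn_holomorphic_solution hb hGd hGeq (eqOn_freeEnergyC_of_eq_ofReal hb htc.1 hGd hGF)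

theorem lemma7p1 (b : ℕ) (hb : 2 ≤ b)
    (tc : ℝ) (htc : tc ∈ Ioo (0 : ℝ) 1) (hfix : renormMap b tc = tc)
    (l : ℕ) (hl : 2 * (b : ℝ) < (deriv (renormMap b) tc) ^ l) :
    ContDiffOn ℝ ∞ (freeEnergy b) (Ico 0 tc) ∧
      (¬ ∃ L : ℝ, Tendsto (iteratedDerivWithin l (freeEnergy b) (Icc 0 tc))
        (𝓝[<] tc) (𝓝 L)) ∧
      ¬ ContinuousWithinAt (iteratedDerivWithin l (freeEnergy b) (Icc 0 tc)) (Icc 0 tc) tc := by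
  have hsmooth : ∀ x ∈ Ico 0 tc, ContDiffAt ℝ ∞ (freeEnergy b) x := fun x hx =>
    contDiffAt_freeEnergy hb htc hfix hl hx
  have hlim : ¬ ∃ L : ℝ, Tendsto (iteratedDerivWithin l (freeEnergy b) (Icc 0 tc))
      (𝓝[<] tc) (𝓝 L) := by
    rintro ⟨L, hL⟩
    obtain ⟨a, ha, hball⟩ := (mem_nhdsLT_iff_exists_Ioo_subset' htc.1).1
      (hL.abs.eventually (gt_mem_nhds (lt_add_one |L|)))
    obtain ⟨x, hx, hxM⟩ := exists_lt_abs_iteratedDerivWithin_freeEnergy hb htc hfix hl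
      (a := max a 0) ⟨le_max_right _ _, max_lt ha htc.1⟩ (|L| + 1)
    have hx0 : x ∈ Ioo 0 tc := ⟨(le_max_right _ _).trans_lt hx.1, hx.2⟩
    have hxl : ContDiffAt ℝ l (freeEnergy b) x :=
      (hsmooth x ⟨hx0.1.le, hx0.2⟩).of_le (by exact_mod_cast le_top)
    -- At interior points the derivatives within `Ioo` and within `Icc` both equal the ordinary one.
    rw [iteratedDerivWithin_eq_iteratedDeriv isOpen_Ioo.uniqueDiffOn hxl hx0,
      ← iteratedDerivWithin_eq_iteratedDeriv (uniqueDiffOn_Icc htc.1) hxl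
        (Ioo_subset_Icc_self hx0)] at hxM
    exact absurd hxM (not_lt.2 (le_of_lt (hball ⟨(le_max_left _ _).trans_lt hx.1, hx.2⟩)))
  refine ⟨fun x hx => (hsmooth x hx).contDiffWithinAt, hlim, fun h => hlim ⟨_, h.tendsto.mono_left ?_⟩⟩
  rw [← nhdsWithin_Ico_eq_nhdsLT htc.1]
  exact nhdsWithin_mono _ Ico_subset_Icc_self
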